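/- \textbf{Setting.} Let $(\Omega,\mathcal F,P)$ be a probability space, $T>0$, and $(\mathcal F_t)_{0\le t\le T}$ a right-continuous filtration with $\mathcal F_T=\mathcal F$. Write $L_\infty(\mathcal F_t)=L_\infty(\Omega,\mathcal F_t,P)$. Inequalities between random variables are $P$-a.s.; $X'>X''$ means $X'\ge X''$ a.s. with strict inequality on a set of positive probability. For every $t\in[0,T]$ let $L_t\subseteq L_\infty(\mathcal F_t)$ be a linear subspace containing the constant $1$ (the marketed claims payable at time $t$). A \emph{price operator} $x:D\to L_\infty(\mathcal F_s)$ on a linear subspace $D\ni 1$ of $L_\infty(\mathcal F_t)$, $s\le t$, is a map that is monotone, strictly monotone ($X'>X''\Rightarrow x(X')>x(X'')$), additive, $\mathcal F_s$-homogeneous ($x(\lambda X)=\lambda x(X)$ whenever $X,\lambda X\in D$ and $0\le \lambda\in L_\infty(\mathcal F_s)$), and satisfies $x(1)=1$. A family $x_{st}:L_t\to L_s$, $0\le s\le t\le T$, is \emph{time-consistent} if $x_{st}(X)=x_{su}(x_{ut}(X))$ for all $s\le u\le t$ and $X\in L_t$, and \emph{right-continuous} if, for all $s\le t$ and $X\in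 L_t$, $x_{s_nt}(X)\to x_{st}(X)$ $P$-a.s. for every sequence $s_n$ in $(s,t]$ with $s_n\downarrow s$. Let $\delta_{st}\ge 0$, $0\le s\le t\le T$, be constants such that $\delta_{rs}\delta_{st}+\delta_{rs}+\delta_{st}=\delta_{rt}$ for all $r\le s\le t$, and $\delta_{st}\to 0$ as $t\downarrow s$. Let $\mathcal Q_{st}$ be the set of probability measures $Q\ll P$ on $\mathcal F_t$ with $Q|_{\mathcal F_s}=P|_{\mathcal F_s}$ and $\frac{dQ}{dP}=1+g$ for some $g\in L_2(\mathcal F_t)$ with $E[g^2|\mathcal F_s]\le \delta_{st}^2$. For $X\in L_\infty^+(\mathcal F_t)$ put $$m_{st}(X)=\operatorname*{ess\,inf}_{Q\in\mathcal Q_{st}}E_Q[X|\mathcal F_s],\qquad M_{st}(X)=\operatorname*{ess\,sup}_{Q\in\mathcal Q_{st}}E_Q[X|\mathcal F_s].$$ A probability measure $Q\sim P$ is a \emph{dynamic no-good-deal pricing measure} (for the constants $\delta_{st}$) if $\frac{dQ}{dP}\in L_2(\mathcal F_T)$ and, with $D_t=E[\frac{dQ}{dP}|\mathcal F_t]$,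 $$E\big[(D_tD_s^{-1}-1)^2\,\big|\,\mathcal F_s\big]\le\delta_{st}^2\qquad\text{for all } s\le t.$$ \textbf{Theorem.} Let $x_{st}:L_t\to L_s$, $0\le s\le t\le T$, be a right-continuous, time-consistent family of price operators satisfying the sandwich condition: for all $s\le t$, $$m_{st}(Z)+x_{st}(X)\le M_{st}(Y)\quad\text{for all }X\in L_t,\ Y,Z\in L^+_\infty(\mathcal F_t)\text{ with } Z+X\le Y.$$ Assume that $m_{0T}(X)>0$ for every $X\in L_\infty(\mathcal F_T)$ with $X>0$. Then there are a time-consistent family of linear price operators $\hat x_{st}:L_\infty(\mathcal F_t)\to L_\infty(\mathcal F_s)$, $0\le s\le t\le T$, and a dynamic no-good-deal pricing measure $P_0\sim P$ (for the same constants $\delta_{st}$) such that, for all $s\le t$: \begin{enumerate} \item $\hat x_{st}(X)=x_{st}(X)$ for $X\in L_t$; \item $m_{st}(X)\le\hat x_{st}(X)\le M_{st}(X)$ for $X\in L^+_\infty(\mathcal F_t)$; \item $\hat x_{st}(X)=E_{P_0}[X|\mathcal F_s]$ for $X\in L_\infty(\mathcal F_t)$. \end{enumerate} -/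

import Mathlib

open MeasureTheory Filter Topology
open scoped ENNReal

namespace NoGoodDeal

section EssentialBounds

variable {Ω : Type*} {mΩ : MeasurableSpace Ω} {P : Measure Ω}

open Classical in
/-- Essential supremum of a family of (classes of) real random variables: its least upper bound
for the `P`-a.s. order. It exists for every nonempty family that is bounded above
(`isLUB_essSupFamily`); otherwise the value is the junk value `0`. -/
noncomputable def essSupFamily (S : Set (Ω →ₘ[P] ℝ)) : Ω →ₘ[P] ℝ :=
  if h : ∃ g, IsLUB S g then h.choose else 0

open Classical in
/-- Essential infimum of a family of (classes of) real random variables: its greatest lower bound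
for the `P`-a.s. order. It exists for every nonempty family that is bounded below
(`isGLB_essInfFamily`); otherwise the value is the junk value `0`. -/
noncomputable def essInfFamily (S : Set (Ω →ₘ[P] ℝ)) : Ω →ₘ[P] ℝ :=
  if h : ∃ g, IsGLB S g then h.choose else 0

theorem integrable_arctan [IsFiniteMeasure P] (f : Ω →ₘ[P] ℝ) :
    Integrable (fun ω => Real.arctan (f ω)) P := by
  refine Integrable.of_bound
    (Real.measurable_arctan.comp_aemeasurable f.aestronglyMeasurable.aemeasurable).aestronglyMeasurable
    (Real.pi / 2) (Eventually.of_forall fun ω => ?_)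
  rw [Real.norm_eq_abs, abs_le]
  exact ⟨by linarith [Real.neg_pi_div_two_lt_arctan (f ω)], (Real.arctan_lt_pi_div_two _).le⟩

theorem exists_isLUB [IsFiniteMeasure P] {S : Set (Ω →ₘ[P] ℝ)} (hne : S.Nonempty)
    (hb : BddAbove S) : ∃ g, IsLUB S g := by
  obtain ⟨b, hb⟩ := hb
  -- close the family under finite suprema
  set S' : Set (Ω →ₘ[P] ℝ) := supClosure S with hS'
  have hbS' : b ∈ upperBounds S' := by rwa [hS', upperBounds_supClosure]
  have hsup : ∀ f ∈ S', ∀ g ∈ S', f ⊔ g ∈ S' := fun f hf g hg => supClosed_supClosure hf hg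
  have hsub : S ⊆ S' := subset_supClosure
  let I : (Ω →ₘ[P] ℝ) → ℝ := fun f => ∫ ω, Real.arctan (f ω) ∂P
  have hImono : ∀ f g : Ω →ₘ[P] ℝ, f ≤ g → I f ≤ I g := fun f g hfg =>
    integral_mono_ae (integrable_arctan f) (integrable_arctan g)
      (AEEqFun.coeFn_le.2 hfg |>.mono fun ω h => Real.arctan_strictMono.monotone h)
  have hIbdd : BddAbove (I '' S') := ⟨I b, by
    rintro _ ⟨f, hf, rfl⟩
    exact hImono f b (hbS' hf)⟩
  have hIne : (I '' S').Nonempty := (hne.mono hsub).image I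
  obtain ⟨u, -, hu, huS⟩ := exists_seq_tendsto_sSup hIne hIbdd
  choose f hfS hfu using huS
  -- partial suprema
  let F : ℕ → (Ω →ₘ[P] ℝ) := partialSups f
  have hFS : ∀ n, F n ∈ S' := by
    intro n
    induction n with
    | zero => simpa [F] using hfS 0
    | succ n ih =>
      have : F (n + 1) = F n ⊔ f (n + 1) := partialSups_add_one f n
      rw [this]
      exact hsup _ ih _ (hfS _)
  have hFmono : Monotone F := (partialSups f).monotone
  have hFI : Tendsto (fun n => I (F n)) atTop (𝓝 (sSup (I '' S'))) := by
    refine tendsto_of_tendsto_of_tendsto_of_le_of_le hu tendsto_const_nhds (fun n => ?_)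
      (fun n => le_csSup hIbdd ⟨_, hFS n, rfl⟩)
    show u n ≤ I (F n)
    rw [← hfu n]
    exact hImono _ _ (le_partialSups f n)
  have hmonoae : ∀ᵐ ω ∂P, Monotone fun n => F n ω := by
    have : ∀ᵐ ω ∂P, ∀ n, F n ω ≤ F (n + 1) ω :=
      ae_all_iff.2 fun n => AEEqFun.coeFn_le.2 (hFmono n.le_succ)
    exact this.mono fun ω h => monotone_nat_of_le_succ h
  have hbae : ∀ᵐ ω ∂P, ∀ n, F n ω ≤ b ω :=
    ae_all_iff.2 fun n => AEEqFun.coeFn_le.2 (hbS' (hFS n))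
  let g : Ω →ₘ[P] ℝ := AEEqFun.mk (fun ω => ⨆ n, F n ω)
    (AEMeasurable.iSup fun n => (F n).aestronglyMeasurable.aemeasurable).aestronglyMeasurable
  have hg : ∀ᵐ ω ∂P, g ω = ⨆ n, F n ω := AEEqFun.coeFn_mk _ _
  have hlim : ∀ᵐ ω ∂P, Tendsto (fun n => F n ω) atTop (𝓝 (g ω)) := by
    filter_upwards [hmonoae, hbae, hg] with ω h1 h2 h3
    rw [h3]
    exact tendsto_atTop_ciSup h1 ⟨b ω, by rintro _ ⟨n, rfl⟩; exact h2 n⟩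
  refine ⟨g, ?_, ?_⟩
  · intro h hh
    have hle : ∀ n, I (h ⊔ F n) ≤ sSup (I '' S') := fun n =>
      le_csSup hIbdd ⟨_, hsup _ (hsub hh) _ (hFS n), rfl⟩
    have key : ∀ (G : ℕ → (Ω →ₘ[P] ℝ)) (k : Ω →ₘ[P] ℝ),
        (∀ᵐ ω ∂P, Tendsto (fun n => G n ω) atTop (𝓝 (k ω))) →
        Tendsto (fun n => I (G n)) atTop (𝓝 (I k)) := by
      intro G k hG
      refine tendsto_integral_of_dominated_convergence (fun _ => Real.pi / 2)
        (fun n => (integrable_arctan (G n)).1) (integrable_const _) (fun n => ?_) ?_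
      · refine Eventually.of_forall fun ω => ?_
        rw [Real.norm_eq_abs, abs_le]
        exact ⟨by linarith [Real.neg_pi_div_two_lt_arctan (G n ω)],
          (Real.arctan_lt_pi_div_two _).le⟩
      · filter_upwards [hG] with ω hω
        exact (Real.continuous_arctan.tendsto _).comp hω
    have hIg : I g = sSup (I '' S') := tendsto_nhds_unique (key F g hlim) hFI
    have hIhg : I (h ⊔ g) ≤ I g := by
      rw [hIg]
      refine le_of_tendsto (key (fun n => h ⊔ F n) (h ⊔ g) ?_) (Eventually.of_forall hle)
      have h1 : ∀ᵐ ω ∂P, ∀ n, (h ⊔ F n : Ω →ₘ[P] ℝ) ω = h ω ⊔ F n ω :=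
        ae_all_iff.2 fun n => AEEqFun.coeFn_sup _ _
      filter_upwards [hlim, h1, AEEqFun.coeFn_sup h g] with ω hω h1 h2
      simp only [h1, h2]
      exact tendsto_const_nhds.sup_nhds hω
    have hle' : ∀ᵐ ω ∂P, Real.arctan (g ω) ≤ Real.arctan ((h ⊔ g : Ω →ₘ[P] ℝ) ω) :=
      (AEEqFun.coeFn_le.2 le_sup_right).mono fun ω h =>
        Real.arctan_strictMono.monotone h
    have heq := (integral_eq_iff_of_ae_le (integrable_arctan g) (integrable_arctan (h ⊔ g)) hle').1
      (le_antisymm (hImono _ _ le_sup_right) hIhg)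
    refine AEEqFun.coeFn_le.1 ?_
    filter_upwards [heq, AEEqFun.coeFn_sup h g] with ω h1 h2
    have : g ω = (h ⊔ g : Ω →ₘ[P] ℝ) ω := Real.arctan_injective h1
    rw [this, h2]
    exact le_sup_left
  · intro k hk
    have hk' : k ∈ upperBounds S' := by rwa [hS', upperBounds_supClosure]
    refine AEEqFun.coeFn_le.1 ?_
    have : ∀ᵐ ω ∂P, ∀ n, F n ω ≤ k ω :=
      ae_all_iff.2 fun n => AEEqFun.coeFn_le.2 (hk' (hFS n))
    filter_upwards [this, hg] with ω h1 h2
    rw [h2]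
    exact ciSup_le h1

theorem isLUB_essSupFamily [IsFiniteMeasure P] {S : Set (Ω →ₘ[P] ℝ)} (hne : S.Nonempty)
    (hb : BddAbove S) : IsLUB S (essSupFamily S) := by
  have h := exists_isLUB hne hb
  rw [essSupFamily, dif_pos h]
  exact h.choose_spec

theorem aeNeg_le {f g : Ω →ₘ[P] ℝ} (h : f ≤ g) : -g ≤ -f := by
  refine AEEqFun.coeFn_le.1 ?_
  filter_upwards [AEEqFun.coeFn_le.2 h, AEEqFun.coeFn_neg f, AEEqFun.coeFn_neg g]
    with ω h1 h2 h3
  rw [h2, h3]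
  exact neg_le_neg h1

theorem isGLB_essInfFamily [IsFiniteMeasure P] {S : Set (Ω →ₘ[P] ℝ)} (hne : S.Nonempty)
    (hb : BddBelow S) : IsGLB S (essInfFamily S) := by
  have h : ∃ g, IsGLB S g := by
    obtain ⟨b, hb⟩ := hb
    obtain ⟨g, hg1, hg2⟩ := exists_isLUB (S := Neg.neg '' S) (hne.image _)
      ⟨-b, by rintro _ ⟨f, hf, rfl⟩; exact aeNeg_le (hb hf)⟩
    refine ⟨-g, fun f hf => ?_, fun k hk => ?_⟩
    · simpa using aeNeg_le (hg1 ⟨f, hf, rfl⟩)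
    · have := hg2 (a := -k) (by rintro _ ⟨f, hf, rfl⟩; exact aeNeg_le (hk hf))
      simpa using aeNeg_le this
  rw [essInfFamily, dif_pos h]
  exact h.choose_spec

end EssentialBounds

section Market

variable {Ω : Type*} {mΩ : MeasurableSpace Ω} {T : ℝ}

/-- `L_∞(F_t)`, as a subspace of `L_∞(Ω, F, P)`. -/
noncomputable abbrev Linf (P : Measure Ω) (F : Filtration (Set.Icc (0 : ℝ) T) mΩ)
    (t : Set.Icc (0 : ℝ) T) : Submodule ℝ (Lp ℝ ∞ P) :=
  lpMeas ℝ ℝ (F t) ∞ P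

/-- The payoff of the numeraire, the constant `1`. -/
noncomputable def one (P : Measure Ω) [IsFiniteMeasure P] : Lp ℝ ∞ P :=
  Lp.const ∞ P (1 : ℝ)

/-- A price operator from a space `D` of claims payable at a later date to a space `E` of claims
payable at time `s`. In `strictMono`, `X' < X` is the strict `P`-a.s. order: `X' ≤ X` a.s. and the
strict inequality holds on a set of positive probability. -/
structure IsPriceOperator (P : Measure Ω) [IsFiniteMeasure P]
    (F : Filtration (Set.Icc (0 : ℝ) T) mΩ) (s : Set.Icc (0 : ℝ) T)
    {D E : Submodule ℝ (Lp ℝ ∞ P)} (x : D → E) : Prop where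
  mono : ∀ X' X : D, (X' : Lp ℝ ∞ P) ≤ X → (x X' : Lp ℝ ∞ P) ≤ x X
  strictMono : ∀ X' X : D, (X' : Lp ℝ ∞ P) < X → (x X' : Lp ℝ ∞ P) < x X
  additive : ∀ X' X : D, x (X' + X) = x X' + x X
  homogeneous : ∀ l ∈ Linf P F s, 0 ≤ l → ∀ X Y : D,
    ((Y : Lp ℝ ∞ P) : Ω → ℝ) =ᵐ[P] (fun ω => l ω * (X : Lp ℝ ∞ P) ω) →
    ((x Y : Lp ℝ ∞ P) : Ω → ℝ) =ᵐ[P] fun ω => l ω * (x X : Lp ℝ ∞ P) ω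
  normalized : ∃ h : one P ∈ D, (x ⟨one P, h⟩ : Lp ℝ ∞ P) = one P

/-- Time-consistency of a family `x s t : D t → D s`, `s ≤ t`. -/
def IsTimeConsistent {P : Measure Ω} {D : Set.Icc (0 : ℝ) T → Submodule ℝ (Lp ℝ ∞ P)}
    (x : ∀ s t : Set.Icc (0 : ℝ) T, D t → D s) : Prop :=
  ∀ s u t : Set.Icc (0 : ℝ) T, s ≤ u → u ≤ t → ∀ X : D t, x s t X = x s u (x u t X)

/-- Right-continuity of a family `x s t : D t → D s`, `s ≤ t`, in the first time variable:
`x s' t X → x s t X` a.s. as `s'` decreases to `s`, along every sequence. -/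
def IsRightContinuousFamily {P : Measure Ω} {D : Set.Icc (0 : ℝ) T → Submodule ℝ (Lp ℝ ∞ P)}
    (x : ∀ s t : Set.Icc (0 : ℝ) T, D t → D s) : Prop :=
  ∀ s t : Set.Icc (0 : ℝ) T, ∀ X : D t, ∀ r : ℕ → Set.Icc (0 : ℝ) T,
    Antitone r → (∀ n, s < r n ∧ r n ≤ t) → Tendsto r atTop (𝓝 s) →
    ∀ᵐ ω ∂P, Tendsto (fun n => (x (r n) t X : Lp ℝ ∞ P) ω) atTop
      (𝓝 ((x s t X : Lp ℝ ∞ P) ω))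

/-- The assumptions on the family of constants `δ s t`, `s ≤ t`. -/
structure IsSharpeBound (δ : Set.Icc (0 : ℝ) T → Set.Icc (0 : ℝ) T → ℝ) : Prop where
  nonneg : ∀ s t, s ≤ t → 0 ≤ δ s t
  comp : ∀ r s t, r ≤ s → s ≤ t → δ r s * δ s t + δ r s + δ s t = δ r t
  tendsto_zero : ∀ s, Tendsto (δ s) (𝓝[>] s) (𝓝 0)

/-- The set `Q_st`. A probability measure on `F_t` that is absolutely continuous with respect
to `P` is identified with the measure on `Ω` having the same (`F_t`-measurable) density. -/
def boundedDensityMeasures (P : Measure Ω) (F : Filtration (Set.Icc (0 : ℝ) T) mΩ)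
    (δ : Set.Icc (0 : ℝ) T → Set.Icc (0 : ℝ) T → ℝ) (s t : Set.Icc (0 : ℝ) T) :
    Set (Measure Ω) :=
  {Q | IsProbabilityMeasure Q ∧ Q ≪ P ∧ Q.trim (F.le s) = P.trim (F.le s) ∧
    ∃ g : Ω → ℝ, StronglyMeasurable[F t] g ∧ MemLp g 2 P ∧
      (fun ω => (Q.rnDeriv P ω).toReal) =ᵐ[P] (fun ω => 1 + g ω) ∧
      P[fun ω => g ω ^ 2 | F s] ≤ᵐ[P] fun _ => δ s t ^ 2}

/-- `E_Q[X | F_s]` as a `P`-class. When `Q` and `P` agree on `F_s`, the `F_s`-measurable versions of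
this conditional expectation, unique up to `Q`-null sets, are unique up to `P`-null sets. -/
noncomputable def condExpClass (P Q : Measure Ω) (F : Filtration (Set.Icc (0 : ℝ) T) mΩ)
    (s : Set.Icc (0 : ℝ) T) (X : Ω → ℝ) : Ω →ₘ[P] ℝ :=
  AEEqFun.mk (Q[X | F s]) (stronglyMeasurable_condExp.mono (F.le s)).aestronglyMeasurable

/-- `M_st(X) = ess sup_{Q ∈ Q_st} E_Q[X | F_s]`. -/
noncomputable def upperBound (P : Measure Ω) (F : Filtration (Set.Icc (0 : ℝ) T) mΩ)
    (δ : Set.Icc (0 : ℝ) T → Set.Icc (0 : ℝ) T → ℝ) (s t : Set.Icc (0 : ℝ) T)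
    (X : Lp ℝ ∞ P) : Ω →ₘ[P] ℝ :=
  essSupFamily ((fun Q => condExpClass P Q F s X) '' boundedDensityMeasures P F δ s t)

/-- `m_st(X) = ess inf_{Q ∈ Q_st} E_Q[X | F_s]`. -/
noncomputable def lowerBound (P : Measure Ω) (F : Filtration (Set.Icc (0 : ℝ) T) mΩ)
    (δ : Set.Icc (0 : ℝ) T → Set.Icc (0 : ℝ) T → ℝ) (s t : Set.Icc (0 : ℝ) T)
    (X : Lp ℝ ∞ P) : Ω →ₘ[P] ℝ :=
  essInfFamily ((fun Q => condExpClass P Q F s X) '' boundedDensityMeasures P F δ s t)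

/-- The density process `(dQ/dP)_t = E[dQ/dP | F_t]`. -/
noncomputable def densityProcess (P Q : Measure Ω) (F : Filtration (Set.Icc (0 : ℝ) T) mΩ)
    (t : Set.Icc (0 : ℝ) T) : Ω → ℝ :=
  P[fun ω => (Q.rnDeriv P ω).toReal | F t]

/-- `Q` is a dynamic no-good-deal pricing measure for the constants `δ`. The integrability in
`bound` makes Mathlib's conditional expectation of the square the true one. -/
structure IsDynamicNoGoodDealMeasure (P : Measure Ω) (F : Filtration (Set.Icc (0 : ℝ) T) mΩ)
    (δ : Set.Icc (0 : ℝ) T → Set.Icc (0 : ℝ) T → ℝ) (Q : Measure Ω) : Prop where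
  isProbabilityMeasure : IsProbabilityMeasure Q
  absolutelyContinuous : Q ≪ P
  absolutelyContinuous' : P ≪ Q
  memLp : MemLp (fun ω => (Q.rnDeriv P ω).toReal) 2 P
  bound : ∀ s t, s ≤ t →
    Integrable (fun ω => (densityProcess P Q F t ω * (densityProcess P Q F s ω)⁻¹ - 1) ^ 2) P ∧
    P[fun ω => (densityProcess P Q F t ω * (densityProcess P Q F s ω)⁻¹ - 1) ^ 2 | F s]
      ≤ᵐ[P] fun _ => δ s t ^ 2

end Market

end NoGoodDeal

/-! ### Compactness and minimax in Hilbert space. -/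

section HilbertSpace

variable {H : Type*} [NormedAddCommGroup H] [InnerProductSpace ℝ H] [CompleteSpace H]

/-! A density `f` reproduces the prices when `E[f (X - x_st X) | F_s] = 0` for every marketed `X`.
The theorem asks for one `f` in `L²` that does this for all `s ≤ t` at once and obeys the
no-good-deal bounds. The compactness used is that of Hilbert space: uniformly bounded closed convex
sets, directed downward, have a common point (`nonempty_iInter_of_directed_of_convex`).

One period. Applied to `X` shifted by a constant, the sandwich condition says that `x_st X` is at
most the essential supremum of `E[f X | F_s]` over the conditional densities `f`. It is attained,
because densities can be pasted along events of `F_s`. So each gain `X - x_st X` has nonnegative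
conditional value under some density. The minimax principle `exists_mem_forall_inner_eq_zero`,
applied to the linear space of `F_s`-simple mixtures of gains, makes the density common to all gains
and, by linearity, the value zero (`exists_mem_condDensities_forall_condExp_eq`).

Many periods. Along finitely many dates, one-period densities are multiplied: time-consistency
carries the prices, and `(1 + δ_rs)(1 + δ_st) = 1 + δ_rt` carries the second moments
(`exists_extend_compatible`). In the homogeneous form `E[E[f|F_t]² | F_s] ≤ (1 + δ_st²) E[f|F_s]²`,
the constraint on a nonnegative `f` is closed and convex, by conditional Cauchy-Schwarz, and the
pair `(0, T)` bounds the norm. Compactness then passes from finite sets of dates to all dates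
(`exists_forall_mem_compatibleDensities`).

Positivity of `m_0T` forces `f > 0`. The measure with density `f` is therefore equivalent to `P`,
and Bayes' formula together with the relative density `E[f|F_t] / E[f|F_s]`
(`exists_mem_condDensities_div`) yields the remaining assertions. -/

/-- The point of least norm of a closed convex set, with its variational inequality. -/
theorem exists_mem_forall_norm_sub_sq_le {K : Set H} (hne : K.Nonempty) (hcl : IsClosed K)
    (hcv : Convex ℝ K) : ∃ v ∈ K, ∀ w ∈ K, ‖w - v‖ ^ 2 ≤ ‖w‖ ^ 2 - ‖v‖ ^ 2 := by
  obtain ⟨v, hv, hmin⟩ := exists_norm_eq_iInf_of_complete_convex hne hcl.isComplete hcv 0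
  refine ⟨v, hv, fun w hw => ?_⟩
  have h := (norm_eq_iInf_iff_real_inner_le_zero hcv hv).1 hmin w hw
  rw [zero_sub, inner_neg_left, inner_sub_right, real_inner_self_eq_norm_sq,
    real_inner_comm] at h
  rw [norm_sub_sq_real]
  linarith

/-- A downward directed family of nonempty bounded closed convex subsets of a Hilbert space has a
common point. -/
theorem nonempty_iInter_of_directed_of_convex {ι : Type*} [Nonempty ι] (K : ι → Set H)
    (hdir : ∀ i j, ∃ k, K k ⊆ K i ∧ K k ⊆ K j) (hne : ∀ i, (K i).Nonempty)
    (hcl : ∀ i, IsClosed (K i)) (hcv : ∀ i, Convex ℝ (K i)) (R : ℝ)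
    (hb : ∀ i, ∀ x ∈ K i, ‖x‖ ≤ R) : (⋂ i, K i).Nonempty := by
  choose p hpK hp using fun i => exists_mem_forall_norm_sub_sq_le (hne i) (hcl i) (hcv i)
  have hbdd : BddAbove (Set.range fun i => ‖p i‖ ^ 2) := by
    refine ⟨R ^ 2, ?_⟩
    rintro _ ⟨i, rfl⟩
    exact pow_le_pow_left₀ (norm_nonneg _) (hb i _ (hpK i)) 2
  set d := ⨆ i, ‖p i‖ ^ 2 with hd
  -- If `K k ⊆ K (i n)`, the variational inequality bounds `‖p k - p (i n)‖ ^ 2` by `‖p k‖ ^ 2 - ‖p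
  -- (i n)‖ ^ 2`. A squared-norm gap of `(1 / (n + 1)) ^ 2` below the supremum thus gives distance
  -- `1 / (n + 1)`.
  have hε : ∀ n : ℕ, 0 < (1 / ((n : ℝ) + 1)) ^ 2 := fun n => by positivity
  choose i hi using fun n : ℕ => exists_lt_of_lt_ciSup (sub_lt_self d (hε n))
  have hclose : ∀ n k, K k ⊆ K (i n) → dist (p k) (p (i n)) ≤ 1 / ((n : ℝ) + 1) := by
    intro n k hk
    have h1 := hp (i n) (p k) (hk (hpK k))
    have h2 : ‖p k‖ ^ 2 ≤ d := le_ciSup hbdd k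
    have h3 := hi n
    rw [dist_eq_norm]
    exact le_of_sq_le_sq (by linarith) (by positivity)
  have hlim0 : Filter.Tendsto (fun n : ℕ => 1 / ((n : ℝ) + 1)) Filter.atTop (nhds 0) :=
    tendsto_one_div_add_atTop_nhds_zero_nat
  have hcau : CauchySeq fun n => p (i n) := by
    refine Metric.cauchySeq_iff'.2 fun ε hε => ?_
    obtain ⟨N, hN⟩ := Filter.eventually_atTop.1 (hlim0.eventually_lt_const (half_pos hε))
    refine ⟨N, fun n hn => ?_⟩
    obtain ⟨k, hk1, hk2⟩ := hdir (i n) (i N)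
    have h1 := hclose n k hk1
    have h2 := hclose N k hk2
    have h3 := dist_triangle_left (p (i n)) (p (i N)) (p k)
    have h4 := hN n hn
    have h5 := hN N le_rfl
    linarith
  obtain ⟨y, hy⟩ := cauchySeq_tendsto_of_complete hcau
  refine ⟨y, Set.mem_iInter.2 fun j => ?_⟩
  -- `K j` need not contain any `p (i n)`, but the least-norm points of sets inside both `K (i n)`
  -- and `K j` do lie in `K j` and have the same limit.
  choose k hk1 hk2 using fun n => hdir (i n) j
  have hky : Filter.Tendsto (fun n => p (k n)) Filter.atTop (nhds y) := by
    refine (tendsto_iff_of_dist ?_).2 hy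
    exact squeeze_zero (fun _ => dist_nonneg) (fun n => hclose n (k n) (hk1 n)) hlim0
  exact (hcl j).mem_of_tendsto hky (Filter.Eventually.of_forall fun n => hk2 n (hpK _))

/-- A continuous linear functional attains its maximum on a nonempty bounded closed convex subset
of a Hilbert space. -/
theorem exists_forall_inner_le {C : Set H} (hne : C.Nonempty) (hcl : IsClosed C)
    (hcv : Convex ℝ C) {R : ℝ} (hb : ∀ x ∈ C, ‖x‖ ≤ R) (v : H) :
    ∃ f ∈ C, ∀ g ∈ C, inner ℝ v g ≤ inner ℝ v f := by
  have hcont : Continuous fun f : H => inner ℝ v f := by fun_prop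
  have hbdd : BddAbove ((fun f => inner ℝ v f) '' C) := by
    refine ⟨‖v‖ * R, ?_⟩
    rintro _ ⟨f, hf, rfl⟩
    exact (real_inner_le_norm v f).trans (mul_le_mul_of_nonneg_left (hb f hf) (norm_nonneg v))
  have : Nonempty C := hne.to_subtype
  -- The superlevel sets of the functional at its own values are nested; a common point is a
  -- maximiser.
  obtain ⟨f, hf⟩ := nonempty_iInter_of_directed_of_convex
    (fun g : C => C ∩ {f | inner ℝ v (g : H) ≤ inner ℝ v f}) (by
      intro i j
      rcases le_total (inner ℝ v (i : H)) (inner ℝ v (j : H)) with h | h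
      · exact ⟨j, fun f hf => ⟨hf.1, h.trans hf.2⟩, fun f hf => hf⟩
      · exact ⟨i, fun f hf => hf, fun f hf => ⟨hf.1, h.trans hf.2⟩⟩)
    (fun g => ⟨g, g.2, le_refl (inner ℝ v (g : H))⟩)
    (fun g => hcl.inter (isClosed_le continuous_const hcont))
    (fun g => hcv.inter (convex_halfSpace_ge (innerSL ℝ v).isLinear _)) R
    (fun g f hf => hb f hf.1)
  rw [Set.mem_iInter] at hf
  obtain ⟨g, hg⟩ := hne
  exact ⟨f, (hf ⟨g, hg⟩).1, fun g hg => (hf ⟨g, hg⟩).2⟩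

/-- A minimax principle: a bounded closed convex set that meets each half-space
`{f | 0 ≤ ⟪v, f⟫}`, `v ∈ N`, meets the orthogonal complement of `N`. -/
theorem exists_mem_forall_inner_eq_zero {C : Set H} (hcl : IsClosed C)
    (hcv : Convex ℝ C) {R : ℝ} (hb : ∀ x ∈ C, ‖x‖ ≤ R) (N : Submodule ℝ H)
    (hN : ∀ v ∈ N, ∃ f ∈ C, 0 ≤ inner ℝ v f) : ∃ f ∈ C, ∀ v ∈ N, inner ℝ v f = 0 := by
  have hR : 0 ≤ R := by
    obtain ⟨f, hf, -⟩ := hN 0 N.zero_mem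
    exact (norm_nonneg f).trans (hb f hf)
  set M : Submodule ℝ H := N.topologicalClosure with hM
  have : CompleteSpace M := N.isClosed_topologicalClosure.completeSpace_coe
  -- The half-space condition survives the closure of `N`: boundedness of `C` makes the maximum over
  -- `C` continuous in `v`.
  have hMC : ∀ v ∈ M, ∃ f ∈ C, 0 ≤ inner ℝ v f := by
    intro v hv
    obtain ⟨g, hg, -⟩ := hN 0 N.zero_mem
    obtain ⟨f, hf, hmax⟩ := exists_forall_inner_le ⟨g, hg⟩ hcl hcv hb v
    refine ⟨f, hf, ?_⟩
    obtain ⟨u, huN, hu⟩ := mem_closure_iff_seq_limit.1 (show v ∈ closure (N : Set H) from hv)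
    have hlow : ∀ n, -(‖v - u n‖ * R) ≤ inner ℝ v f := by
      intro n
      obtain ⟨k, hk, hk0⟩ := hN _ (huN n)
      have h1 : inner ℝ v k = inner ℝ (u n) k + inner ℝ (v - u n) k := by
        rw [← inner_add_left]; congr 1; abel
      have h2 := abs_le.1 ((abs_real_inner_le_norm (v - u n) k).trans
        (mul_le_mul_of_nonneg_left (hb k hk) (norm_nonneg _)))
      linarith [hmax k hk, h2.1]
    have hlim : Filter.Tendsto (fun n => -(‖v - u n‖ * R)) Filter.atTop (nhds 0) := by
      simpa using (((tendsto_const_nhds (x := v)).sub hu).norm.mul_const R).neg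
    exact le_of_tendsto hlim (Filter.Eventually.of_forall hlow)
  have hproj : ∀ v ∈ M, ∀ f, inner ℝ v f = inner ℝ v (M.starProjection f) := by
    intro v hv f
    rw [← Submodule.inner_starProjection_left_eq_right, Submodule.starProjection_eq_self_iff.2 hv]
  -- points of `C` with arbitrarily small projection
  have hsmall : ∀ ε : ℝ, 0 < ε → ∃ f ∈ C, ‖M.starProjection f‖ ≤ ε := by
    set D := closure (M.starProjection '' C) with hD
    have hDne : D.Nonempty := by
      obtain ⟨f, hf, -⟩ := hN 0 N.zero_mem
      exact ⟨_, subset_closure ⟨f, hf, rfl⟩⟩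
    have hDcv : Convex ℝ D := (hcv.linear_image (M.starProjection : H →ₗ[ℝ] H)).closure
    obtain ⟨v, hv, hvmin⟩ := exists_mem_forall_norm_sub_sq_le hDne isClosed_closure hDcv
    have hvM : v ∈ M := by
      refine closure_minimal ?_ N.isClosed_topologicalClosure hv
      rintro _ ⟨f, -, rfl⟩
      exact Submodule.starProjection_apply_mem _ _
    -- Testing with `-v` gives a projected point with nonpositive inner product with `v`. The
    -- variational inequality at the least-norm point `v` says that this inner product is at least
    -- `‖v‖ ^ 2`, so `v = 0`.
    obtain ⟨f, hf, hf0⟩ := hMC (-v) (M.neg_mem hvM)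
    have h1 := hvmin _ (subset_closure ⟨f, hf, rfl⟩)
    rw [inner_neg_left, hproj v hvM, real_inner_comm] at hf0
    rw [norm_sub_sq_real] at h1
    have hv0 : v = 0 := by
      have : ‖v‖ ^ 2 ≤ 0 := by linarith
      simpa using this
    intro ε hε
    rw [hv0] at hv
    obtain ⟨_, ⟨g, hg, rfl⟩, hgε⟩ := Metric.mem_closure_iff.1 hv ε hε
    exact ⟨g, hg, by simpa using hgε.le⟩
  -- Zero is so far known only to lie in the closure of the projection of `C`; compactness of `C`
  -- makes it attained.
  obtain ⟨f, hf⟩ := nonempty_iInter_of_directed_of_convex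
    (fun ε : Set.Ioi (0 : ℝ) => C ∩ {f | ‖M.starProjection f‖ ≤ ε}) (by
      intro i j
      rcases le_total i j with h | h
      · exact ⟨i, fun f hf => hf, fun f hf => ⟨hf.1, show ‖M.starProjection f‖ ≤ _ from hf.2.trans h⟩⟩
      · exact ⟨j, fun f hf => ⟨hf.1, show ‖M.starProjection f‖ ≤ _ from hf.2.trans h⟩, fun f hf => hf⟩)
    (fun ε => hsmall ε ε.2)
    (fun ε => hcl.inter (isClosed_le (by fun_prop) continuous_const))
    (fun ε => hcv.inter (by
      have : {f | ‖M.starProjection f‖ ≤ ε} = M.starProjection ⁻¹' Metric.closedBall 0 ε := by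
        ext f; simp
      rw [this]
      exact (convex_closedBall _ _).linear_preimage (M.starProjection : H →ₗ[ℝ] H))) R
    (fun ε f hf => hb f hf.1)
  rw [Set.mem_iInter] at hf
  refine ⟨f, (hf ⟨1, one_pos (α := ℝ)⟩).1, fun v hv => ?_⟩
  have h0 : M.starProjection f = 0 := by
    rw [← norm_le_zero_iff]
    exact le_of_forall_pos_le_add fun ε hε => by simpa using (hf ⟨ε, hε⟩).2
  rw [hproj v (N.le_topologicalClosure hv), h0, inner_zero_right]

end HilbertSpace

/-! ### Conditional inequalities tested on events, and Bayes' formula. -/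

section ConditionalExpectation

variable {Ω : Type*} {m mΩ : MeasurableSpace Ω} {P : Measure Ω}

theorem condExp_le_condExp_of_forall_setIntegral_le [IsFiniteMeasure P] (hm : m ≤ mΩ) {f g : Ω → ℝ}
    (hf : Integrable f P) (hg : Integrable g P)
    (h : ∀ A, MeasurableSet[m] A → ∫ ω in A, f ω ∂P ≤ ∫ ω in A, g ω ∂P) :
    P[f | m] ≤ᵐ[P] P[g | m] := by
  refine ae_le_of_ae_le_trim (hm := hm) (ae_le_of_forall_setIntegral_le
    (integrable_condExp.trim hm stronglyMeasurable_condExp)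
    (integrable_condExp.trim hm stronglyMeasurable_condExp) fun A hA _ => ?_)
  rw [← setIntegral_trim hm stronglyMeasurable_condExp hA,
    ← setIntegral_trim hm stronglyMeasurable_condExp hA, setIntegral_condExp hm hf hA,
    setIntegral_condExp hm hg hA]
  exact h A hA

theorem condExp_eq_condExp_of_forall_setIntegral_eq [IsFiniteMeasure P] (hm : m ≤ mΩ) {f g : Ω → ℝ}
    (hf : Integrable f P) (hg : Integrable g P)
    (h : ∀ A, MeasurableSet[m] A → ∫ ω in A, f ω ∂P = ∫ ω in A, g ω ∂P) :
    P[f | m] =ᵐ[P] P[g | m] :=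
  (condExp_le_condExp_of_forall_setIntegral_le hm hf hg fun A hA => (h A hA).le).antisymm
    (condExp_le_condExp_of_forall_setIntegral_le hm hg hf fun A hA => (h A hA).ge)

theorem setIntegral_le_of_condExp_le [IsFiniteMeasure P] (hm : m ≤ mΩ) {f g : Ω → ℝ}
    (hf : Integrable f P) (hg : Integrable g P) (h : P[f | m] ≤ᵐ[P] P[g | m]) {A : Set Ω}
    (hA : MeasurableSet[m] A) : ∫ ω in A, f ω ∂P ≤ ∫ ω in A, g ω ∂P := by
  rw [← setIntegral_condExp hm hf hA, ← setIntegral_condExp hm hg hA]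
  exact setIntegral_mono_ae integrable_condExp.integrableOn integrable_condExp.integrableOn h

theorem setIntegral_eq_of_condExp_eq [IsFiniteMeasure P] (hm : m ≤ mΩ) {f g : Ω → ℝ}
    (hf : Integrable f P) (hg : Integrable g P) (h : P[f | m] =ᵐ[P] P[g | m]) {A : Set Ω}
    (hA : MeasurableSet[m] A) : ∫ ω in A, f ω ∂P = ∫ ω in A, g ω ∂P :=
  (setIntegral_le_of_condExp_le hm hf hg h.le hA).antisymm
    (setIntegral_le_of_condExp_le hm hg hf h.symm.le hA)

/-- The hypothesis compares the measures with densities `u` and `v`, restricted to `m`; both sides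
integrate the `m`-measurable `h` against them. -/
theorem lintegral_mul_le_of_forall_setLIntegral_le (hm : m ≤ mΩ) {u v h : Ω → ℝ≥0∞}
    (hu : AEMeasurable u P) (hv : AEMeasurable v P) (hh : Measurable[m] h)
    (huv : ∀ A, MeasurableSet[m] A → ∫⁻ ω in A, u ω ∂P ≤ ∫⁻ ω in A, v ω ∂P) :
    ∫⁻ ω, u ω * h ω ∂P ≤ ∫⁻ ω, v ω * h ω ∂P := by
  have key : ∀ w : Ω → ℝ≥0∞, AEMeasurable w P →
      ∫⁻ ω, w ω * h ω ∂P = ∫⁻ ω, h ω ∂((P.withDensity w).trim hm) := fun w hw => by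
    rw [lintegral_trim hm hh,
      lintegral_withDensity_eq_lintegral_mul₀ hw (hh.mono hm le_rfl).aemeasurable]
    rfl
  rw [key u hu, key v hv]
  refine lintegral_mono' (Measure.le_iff.2 fun A hA => ?_) le_rfl
  rw [trim_measurableSet_eq hm hA, trim_measurableSet_eq hm hA, withDensity_apply _ (hm _ hA),
    withDensity_apply _ (hm _ hA)]
  exact huv A hA

/-- A conditional comparison of second moments is preserved by multiplication with a random
variable that is measurable for the conditioning σ-algebra. -/
theorem memLp_mul_and_setIntegral_sq_le (hm : m ≤ mΩ) {w z h : Ω → ℝ} (hw : MemLp w 2 P)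
    (hz : MemLp z 2 P) (hh : AEStronglyMeasurable[m] h P) (hhz : MemLp (fun ω => h ω * z ω) 2 P)
    (hwz : ∀ A, MeasurableSet[m] A → ∫ ω in A, w ω ^ 2 ∂P ≤ ∫ ω in A, z ω ^ 2 ∂P) :
    MemLp (fun ω => h ω * w ω) 2 P ∧ ∀ A, MeasurableSet[m] A →
      ∫ ω in A, (h ω * w ω) ^ 2 ∂P ≤ ∫ ω in A, (h ω * z ω) ^ 2 ∂P := by
  obtain ⟨k, hk, hhk⟩ := hh
  have hof : ∀ {y : Ω → ℝ}, MemLp y 2 P → ∀ A,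
      ENNReal.ofReal (∫ ω in A, y ω ^ 2 ∂P) = ∫⁻ ω in A, ENNReal.ofReal (y ω ^ 2) ∂P :=
    fun hy A => ofReal_integral_eq_lintegral_ofReal hy.integrable_sq.integrableOn
      (Eventually.of_forall fun ω => sq_nonneg _)
  have hkm : Measurable[m] fun ω => ENNReal.ofReal (k ω ^ 2) :=
    ENNReal.measurable_ofReal.comp (hk.measurable.pow_const 2)
  -- The comparison is made with lower Lebesgue integrals, because square-integrability of `h * w`
  -- is a conclusion: it follows from the case of the whole space.
  have key : ∀ A, MeasurableSet[m] A → ∫⁻ ω in A, ENNReal.ofReal ((h ω * w ω) ^ 2) ∂P ≤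
      ∫⁻ ω in A, ENNReal.ofReal ((h ω * z ω) ^ 2) ∂P := by
    intro A hA
    have h1 := lintegral_mul_le_of_forall_setLIntegral_le (P := P) hm
      (u := fun ω => ENNReal.ofReal (w ω ^ 2)) (v := fun ω => ENNReal.ofReal (z ω ^ 2))
      (h := A.indicator fun ω => ENNReal.ofReal (k ω ^ 2))
      (hw.1.aemeasurable.pow_const 2).ennreal_ofReal (hz.1.aemeasurable.pow_const 2).ennreal_ofReal
      (hkm.indicator hA) (fun B hB => by
        rw [← hof hw, ← hof hz]
        exact ENNReal.ofReal_le_ofReal (hwz B hB))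
    have h2 : ∀ y : Ω → ℝ, ∫⁻ ω in A, ENNReal.ofReal ((h ω * y ω) ^ 2) ∂P =
        ∫⁻ ω, ENNReal.ofReal (y ω ^ 2) * A.indicator (fun ω => ENNReal.ofReal (k ω ^ 2)) ω ∂P := by
      intro y
      rw [← lintegral_indicator (hm _ hA)]
      refine lintegral_congr_ae ?_
      filter_upwards [hhk] with ω hω
      by_cases hωA : ω ∈ A
      · simp only [Set.indicator_of_mem hωA, hω]
        rw [mul_pow, mul_comm, ENNReal.ofReal_mul (sq_nonneg _)]
      · simp [Set.indicator_of_notMem hωA]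
    rw [h2, h2]
    exact h1
  have hm1 : AEStronglyMeasurable (fun ω => h ω * w ω) P :=
    AEStronglyMeasurable.mul ⟨k, hk.mono hm, hhk⟩ hw.1
  have hL : MemLp (fun ω => h ω * w ω) 2 P := by
    refine (memLp_two_iff_integrable_sq hm1).2 ⟨hm1.pow 2, ?_⟩
    rw [hasFiniteIntegral_iff_ofReal (Eventually.of_forall fun ω => sq_nonneg _)]
    have h1 := key Set.univ MeasurableSet.univ
    rw [← hof hhz, Measure.restrict_univ] at h1
    exact h1.trans_lt ENNReal.ofReal_lt_top
  refine ⟨hL, fun A hA => ?_⟩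
  have h1 := key A hA
  rw [← hof hhz, ← hof hL] at h1
  exact (ENNReal.ofReal_le_ofReal_iff (integral_nonneg fun ω => sq_nonneg _)).1 h1

/-- Bayes' formula for conditional expectations. -/
theorem condExp_mul_eq_condExp_withDensity (hm : m ≤ mΩ) {f X : Ω → ℝ} [IsFiniteMeasure P]
    (hf : Integrable f P) (hf0 : 0 ≤ᵐ[P] f) (hfX : Integrable (fun ω => f ω * X ω) P) :
    P[fun ω => f ω * X ω | m] =ᵐ[P]
      fun ω => (P[f | m]) ω * ((P.withDensity fun ω => ENNReal.ofReal (f ω))[X | m]) ω := by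
  set Q := P.withDensity fun ω => ENNReal.ofReal (f ω) with hQ
  have hfm : AEMeasurable (fun ω => ENNReal.ofReal (f ω)) P := hf.1.aemeasurable.ennreal_ofReal
  have : IsFiniteMeasure Q := isFiniteMeasure_withDensity_ofReal hf.2
  have htop : ∀ᵐ ω ∂P, ENNReal.ofReal (f ω) < ∞ := Eventually.of_forall fun _ => ENNReal.ofReal_lt_top
  have hint : ∀ Y : Ω → ℝ, Integrable Y Q ↔ Integrable (fun ω => f ω * Y ω) P := by
    intro Y
    rw [hQ, integrable_withDensity_iff_integrable_smul₀' hfm htop]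
    refine integrable_congr ?_
    filter_upwards [hf0] with ω hω
    rw [ENNReal.toReal_ofReal hω, smul_eq_mul]
  have hset : ∀ (Y : Ω → ℝ) A, MeasurableSet A → ∫ ω in A, Y ω ∂Q = ∫ ω in A, f ω * Y ω ∂P := by
    intro Y A hA
    rw [hQ, setIntegral_withDensity_eq_setIntegral_toReal_smul₀ hfm.restrict
      (ae_restrict_of_ae htop) _ hA]
    refine setIntegral_congr_ae hA ?_
    filter_upwards [hf0] with ω hω _
    rw [ENNReal.toReal_ofReal hω, smul_eq_mul]
  have hX : Integrable X Q := (hint X).2 hfX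
  have hY : Integrable (fun ω => f ω * (Q[X | m]) ω) P := (hint _).1 integrable_condExp
  -- Inside the expectation `X` can be replaced by its `m`-measurable version under `Q`, which then
  -- factors out.
  have h1 : P[fun ω => f ω * X ω | m] =ᵐ[P] P[fun ω => f ω * (Q[X | m]) ω | m] := by
    refine condExp_eq_condExp_of_forall_setIntegral_eq hm hfX hY fun A hA => ?_
    rw [← hset _ A (hm A hA), ← hset _ A (hm A hA), setIntegral_condExp hm hX hA]
  exact h1.trans (condExp_mul_of_stronglyMeasurable_right stronglyMeasurable_condExp hY hf)

end ConditionalExpectation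

/-! ### Conditional densities: closedness, convexity, pasting, and conditional minimax. -/

section ConditionalDensities

variable {Ω : Type*} {m n mΩ : MeasurableSpace Ω} {P : Measure Ω}

theorem inner_toLp_eq_integral {v : Ω → ℝ} (hv : MemLp v 2 P) (f : Lp ℝ 2 P) :
    inner ℝ (hv.toLp v) f = ∫ ω, f ω * v ω ∂P := by
  rw [L2.inner_def]
  refine integral_congr_ae ?_
  filter_upwards [hv.coeFn_toLp] with ω hω
  simp [hω]

theorem norm_sq_restrict_eq (A : Set Ω) (f : Lp ℝ 2 P) :
    ‖LpToLpRestrictCLM Ω ℝ ℝ P 2 A f‖ ^ 2 = ∫ ω in A, f ω ^ 2 ∂P := by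
  rw [← real_inner_self_eq_norm_sq, L2.inner_def]
  refine integral_congr_ae ?_
  filter_upwards [LpToLpRestrictCLM_coeFn (𝕜 := ℝ) A f] with ω hω
  simp [hω, sq]

theorem norm_sq_eq_integral_sq (f : Lp ℝ 2 P) : ‖f‖ ^ 2 = ∫ ω, f ω ^ 2 ∂P := by
  rw [← real_inner_self_eq_norm_sq, L2.inner_def]
  simp [sq]

theorem memLp_two_of_Linf [IsFiniteMeasure P] (X : Lp ℝ ∞ P) : MemLp X 2 P :=
  (Lp.memLp X).mono_exponent le_top

theorem integrable_mul_Linf [IsFiniteMeasure P] {f : Ω → ℝ} (hf : MemLp f 2 P) (X : Lp ℝ ∞ P) :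
    Integrable (fun ω => f ω * X ω) P :=
  hf.integrable_mul (memLp_two_of_Linf X)

theorem convex_Lp_nonneg : Convex ℝ {f : Lp ℝ 2 P | 0 ≤ f} := by
  intro f (hf : 0 ≤ f) g (hg : 0 ≤ g) a b ha hb _
  have h : ∀ (r : ℝ) (k : Lp ℝ 2 P), 0 ≤ r → 0 ≤ k → 0 ≤ r • k := fun r k hr hk => by
    rw [← Lp.coeFn_nonneg] at *
    filter_upwards [hk, Lp.coeFn_smul r k] with ω h1 h2
    rw [h2]
    exact mul_nonneg hr h1
  exact add_nonneg (h a f ha hf) (h b g hb hg)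

/-- The square-integrable densities, measurable for `n`, of the probability measures that agree
with `P` on `m` and have conditional second moment at most `c`. -/
def condDensities (P : Measure Ω) (m n : MeasurableSpace Ω) (c : ℝ) : Set (Lp ℝ 2 P) :=
  {f | 0 ≤ f ∧ AEStronglyMeasurable[n] f P ∧
    (∀ A, MeasurableSet[m] A → ∫ ω in A, f ω ∂P = P.real A) ∧
    ∀ A, MeasurableSet[m] A → ∫ ω in A, f ω ^ 2 ∂P ≤ c * P.real A}

variable {c : ℝ} [IsProbabilityMeasure P]

theorem norm_le_of_mem_condDensities {f : Lp ℝ 2 P} (hf : f ∈ condDensities P m n c) :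
    ‖f‖ ≤ √c := by
  refine Real.le_sqrt_of_sq_le ?_
  have := hf.2.2.2 Set.univ MeasurableSet.univ
  simpa [norm_sq_eq_integral_sq] using this

theorem setIntegral_eq_inner {A : Set Ω} (hA : MeasurableSet A) (f : Lp ℝ 2 P) :
    ∫ ω in A, f ω ∂P = inner ℝ (indicatorConstLp 2 hA (measure_ne_top P A) (1 : ℝ)) f :=
  (L2.inner_indicatorConstLp_one hA _ f).symm

/-- Written on events, each constraint is continuous in `L²`: the first is an inner product with an
indicator, the second a norm after restriction to `A`. -/
theorem isClosed_condDensities (hm : m ≤ mΩ) (hn : n ≤ mΩ) :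
    IsClosed (condDensities P m n c) := by
  have h3 : IsClosed {f : Lp ℝ 2 P | ∀ A, MeasurableSet[m] A → ∫ ω in A, f ω ∂P = P.real A} := by
    simp only [Set.ofPred_forall]
    refine isClosed_iInter fun A => isClosed_iInter fun hA => ?_
    simp only [setIntegral_eq_inner (hm A hA)]
    exact isClosed_eq (by fun_prop) continuous_const
  have h4 : IsClosed {f : Lp ℝ 2 P | ∀ A, MeasurableSet[m] A →
      ∫ ω in A, f ω ^ 2 ∂P ≤ c * P.real A} := by
    simp only [Set.ofPred_forall]
    refine isClosed_iInter fun A => isClosed_iInter fun hA => ?_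
    simp only [← norm_sq_restrict_eq]
    exact isClosed_le (by fun_prop) continuous_const
  exact (isClosed_Ici.inter ((isClosed_aestronglyMeasurable hn).inter (h3.inter h4)))

theorem convex_condDensities (hm : m ≤ mΩ) : Convex ℝ (condDensities P m n c) := by
  rintro f ⟨hf1, hf2, hf3, hf4⟩ g ⟨hg1, hg2, hg3, hg4⟩ a b ha hb hab
  refine ⟨convex_Lp_nonneg hf1 hg1 ha hb hab, ?_, fun A hA => ?_, fun A hA => ?_⟩
  · rw [← mem_lpMeas_iff_aestronglyMeasurable (𝕜 := ℝ)] at *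
    exact add_mem (Submodule.smul_mem _ a hf2) (Submodule.smul_mem _ b hg2)
  · have h1 := hf3 A hA
    have h2 := hg3 A hA
    rw [setIntegral_eq_inner (hm A hA)] at *
    rw [inner_add_right, inner_smul_right, inner_smul_right, h1, h2, ← add_mul, hab, one_mul]
  · have h1 := hf4 A hA
    have h2 := hg4 A hA
    rw [← norm_sq_restrict_eq] at *
    set r := c * P.real A
    have hr : 0 ≤ r := (sq_nonneg _).trans h1
    have h3 := Real.le_sqrt_of_sq_le h1
    have h4 := Real.le_sqrt_of_sq_le h2
    have h5 := (convex_closedBall (0 : Lp ℝ 2 (P.restrict A)) (√r))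
      (mem_closedBall_zero_iff.2 h3) (mem_closedBall_zero_iff.2 h4) ha hb hab
    rw [mem_closedBall_zero_iff] at h5
    rw [map_add, map_smul, map_smul]
    exact (Real.le_sqrt (norm_nonneg _) hr).1 h5

/-- Pasting two conditional densities along an event of the conditioning σ-algebra. -/
theorem exists_mem_condDensities_paste (hm : m ≤ mΩ) (hmn : m ≤ n) {f g : Lp ℝ 2 P}
    (hf : f ∈ condDensities P m n c) (hg : g ∈ condDensities P m n c) {B : Set Ω}
    (hB : MeasurableSet[m] B) :
    ∃ h ∈ condDensities P m n c, (∀ᵐ ω ∂P, ω ∈ B → h ω = f ω) ∧ ∀ᵐ ω ∂P, ω ∉ B → h ω = g ω := by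
  have hLp : MemLp (fun ω => B.indicator f ω + Bᶜ.indicator g ω) 2 P :=
    ((Lp.memLp f).indicator (hm B hB)).add ((Lp.memLp g).indicator (hm B hB).compl)
  have h1 : ∀ᵐ ω ∂P, ω ∈ B → hLp.toLp _ ω = f ω := by
    filter_upwards [hLp.coeFn_toLp] with ω hω hωB
    rw [hω]; simp [hωB]
  have h2 : ∀ᵐ ω ∂P, ω ∉ B → hLp.toLp _ ω = g ω := by
    filter_upwards [hLp.coeFn_toLp] with ω hω hωB
    rw [hω]; simp [hωB]
  have hsplit : ∀ (u : ℝ → ℝ) A, MeasurableSet[m] A →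
      IntegrableOn (fun ω => u (hLp.toLp _ ω)) A P →
      ∫ ω in A, u (hLp.toLp _ ω) ∂P = ∫ ω in A ∩ B, u (f ω) ∂P + ∫ ω in A \ B, u (g ω) ∂P := by
    intro u A hA hi
    rw [← integral_inter_add_sdiff (hm B hB) hi]
    congr 1
    · refine setIntegral_congr_ae ((hm A hA).inter (hm B hB)) ?_
      filter_upwards [h1] with ω hω hωA
      rw [hω hωA.2]
    · refine setIntegral_congr_ae ((hm A hA).diff (hm B hB)) ?_
      filter_upwards [h2] with ω hω hωA
      rw [hω hωA.2]
  refine ⟨hLp.toLp _, ⟨?_, ?_, fun A hA => ?_, fun A hA => ?_⟩, h1, h2⟩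
  · rw [← Lp.coeFn_nonneg]
    filter_upwards [h1, h2, (Lp.coeFn_nonneg f).2 hf.1, (Lp.coeFn_nonneg g).2 hg.1]
      with ω h1 h2 h3 h4
    by_cases hω : ω ∈ B
    · rw [h1 hω]; exact h3
    · rw [h2 hω]; exact h4
  · have h0 : MeasurableSet[n] B := hmn B hB
    have h3 : AEStronglyMeasurable[n] (B.indicator f) P := by
      obtain ⟨k, hk, hfk⟩ := hf.2.1
      exact ⟨B.indicator k, hk.indicator h0, hfk.indicator⟩
    have h4 : AEStronglyMeasurable[n] (Bᶜ.indicator g) P := by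
      obtain ⟨k, hk, hgk⟩ := hg.2.1
      exact ⟨Bᶜ.indicator k, hk.indicator h0.compl, hgk.indicator⟩
    exact (h3.add h4).congr hLp.coeFn_toLp.symm
  · rw [hsplit (fun r => r) A hA ((Lp.memLp _).integrable one_le_two).integrableOn,
      hf.2.2.1 _ (hA.inter hB), hg.2.2.1 _ (hA.diff hB), measureReal_inter_add_sdiff (hm B hB)]
  · rw [hsplit (fun r => r ^ 2) A hA (Lp.memLp _).integrable_sq.integrableOn]
    have h3 := hf.2.2.2 _ (hA.inter hB)
    have h4 := hg.2.2.2 _ (hA.diff hB)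
    rw [← measureReal_inter_add_sdiff (hm B hB), mul_add]
    exact add_le_add h3 h4

/-- Two-set pasting, iterated over the fibres of `φ`. It lets the choice of density depend on a
finite amount of `m`-measurable information. -/
theorem exists_mem_condDensities_paste_finset (hm : m ≤ mΩ) (hmn : m ≤ n) {ι : Type*}
    (φ : Ω → ι) (hφ : ∀ a, MeasurableSet[m] (φ ⁻¹' {a})) (f : ι → Lp ℝ 2 P)
    (hf : ∀ a, f a ∈ condDensities P m n c) (hne : (condDensities P m n c).Nonempty)
    (R : Finset ι) :
    ∃ h ∈ condDensities P m n c, ∀ a ∈ R, ∀ᵐ ω ∂P, φ ω = a → h ω = f a ω := by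
  classical
  induction R using Finset.induction_on with
  | empty => exact ⟨hne.some, hne.some_mem, by simp⟩
  | insert a R ha ih =>
    obtain ⟨h, hh, hR⟩ := ih
    obtain ⟨k, hk, h1, h2⟩ := exists_mem_condDensities_paste hm hmn (hf a) hh (hφ a)
    refine ⟨k, hk, fun b hb => ?_⟩
    rcases Finset.mem_insert.1 hb with rfl | hb
    · filter_upwards [h1] with ω hω hωb using hω hωb
    · filter_upwards [h2, hR b hb] with ω h2 h3 hωb
      rw [h2 (fun h : φ ω = a => ha (by rwa [← h, hωb])), h3 hωb]

/-- The essential supremum of the conditional expectations `E[f X | m]` is attained. -/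
theorem exists_forall_condExp_mul_le (hm : m ≤ mΩ) (hn : n ≤ mΩ) (hmn : m ≤ n)
    (hne : (condDensities P m n c).Nonempty) (X : Lp ℝ ∞ P) :
    ∃ f ∈ condDensities P m n c, ∀ g ∈ condDensities P m n c,
      P[fun ω => g ω * X ω | m] ≤ᵐ[P] P[fun ω => f ω * X ω | m] := by
  obtain ⟨f, hf, hmax⟩ := exists_forall_inner_le hne (isClosed_condDensities hm hn)
    (convex_condDensities hm) (fun _ => norm_le_of_mem_condDensities) ((memLp_two_of_Linf X).toLp X)
  have hint : ∀ g : Lp ℝ 2 P, Integrable (fun ω => g ω * X ω) P := fun g =>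
    integrable_mul_Linf (Lp.memLp g) X
  refine ⟨f, hf, fun g hg => condExp_le_condExp_of_forall_setIntegral_le hm (hint g) (hint f)
    fun A hA => ?_⟩
  -- If `g` did better than `f` on `A`, then `g` on `A` pasted to `f` off `A` would beat the
  -- unconditional maximiser `f`.
  obtain ⟨h, hh, h1, h2⟩ := exists_mem_condDensities_paste hm hmn hg hf hA
  have h3 := hmax h hh
  rw [inner_toLp_eq_integral, inner_toLp_eq_integral, ← integral_add_compl (hm A hA) (hint h),
    ← integral_add_compl (hm A hA) (hint f)] at h3
  have h4 : ∫ ω in A, h ω * X ω ∂P = ∫ ω in A, g ω * X ω ∂P := by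
    refine setIntegral_congr_ae (hm A hA) ?_
    filter_upwards [h1] with ω hω hωA
    rw [hω hωA]
  have h5 : ∫ ω in Aᶜ, h ω * X ω ∂P = ∫ ω in Aᶜ, f ω * X ω ∂P := by
    refine setIntegral_congr_ae (hm A hA).compl ?_
    filter_upwards [h2] with ω hω hωA
    rw [hω hωA]
  linarith

/-- If each element of a space of claims has nonnegative conditional value under some conditional
density, then all of them have zero conditional value under a common one. -/
theorem exists_mem_condDensities_forall_setIntegral_eq_zero (hm : m ≤ mΩ) (hn : n ≤ mΩ)
    (hmn : m ≤ n) {D : Type*} [AddCommGroup D] [Module ℝ D] (y : D →ₗ[ℝ] Lp ℝ ∞ P)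
    (hy : ∀ a, ∃ f ∈ condDensities P m n c, ∀ A, MeasurableSet[m] A →
      0 ≤ ∫ ω in A, f ω * y a ω ∂P) :
    ∃ f ∈ condDensities P m n c, ∀ a A, MeasurableSet[m] A → ∫ ω in A, f ω * y a ω ∂P = 0 := by
  classical
  have hrange : ∀ φ : @SimpleFunc Ω m D, (Set.range φ).Countable := fun φ =>
    (@SimpleFunc.finite_range _ _ m φ).countable
  -- Claims chosen scenario by scenario with finitely many `m`-measurable alternatives. Localising
  -- in this way makes orthogonality to `N` a conditional statement. Countable ranges allow the a.e.
  -- linearity identities to hold for all values simultaneously.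
  let N : Submodule ℝ (Lp ℝ 2 P) :=
    { carrier := {v | ∃ φ : @SimpleFunc Ω m D, ∀ᵐ ω ∂P, v ω = y (φ ω) ω}
      zero_mem' := by
        refine ⟨@SimpleFunc.const _ _ m 0, ?_⟩
        filter_upwards [Lp.coeFn_zero ℝ 2 P, Lp.coeFn_zero ℝ ∞ P] with ω h1 h2
        rw [h1, @SimpleFunc.const_apply _ _ m, map_zero, h2]
      add_mem' := by
        rintro v w ⟨φ, hφ⟩ ⟨ψ, hψ⟩
        refine ⟨φ + ψ, ?_⟩
        have hadd : ∀ᵐ ω ∂P, ∀ a ∈ Set.range φ, ∀ b ∈ Set.range ψ,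
            y (a + b) ω = y a ω + y b ω := by
          refine (ae_ball_iff (hrange φ)).2 fun a _ => (ae_ball_iff (hrange ψ)).2 fun b _ => ?_
          rw [map_add]
          exact Lp.coeFn_add _ _
        filter_upwards [hφ, hψ, hadd, Lp.coeFn_add v w] with ω h1 h2 h3 h4
        rw [h4, Pi.add_apply, h1, h2, @SimpleFunc.add_apply _ _ m,
          h3 _ (Set.mem_range_self ω) _ (Set.mem_range_self ω)]
      smul_mem' := by
        rintro r v ⟨φ, hφ⟩
        refine ⟨r • φ, ?_⟩
        have hsmul : ∀ᵐ ω ∂P, ∀ a ∈ Set.range φ, y (r • a) ω = r * y a ω := by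
          refine (ae_ball_iff (hrange φ)).2 fun a _ => ?_
          rw [map_smul]
          exact Lp.coeFn_smul _ _
        filter_upwards [hφ, hsmul, Lp.coeFn_smul r v] with ω h1 h2 h3
        rw [h3, Pi.smul_apply, smul_eq_mul, h1, @SimpleFunc.smul_apply _ _ m,
          h2 _ (Set.mem_range_self ω)] }
  choose F hF hF0 using hy
  have hne : (condDensities P m n c).Nonempty := ⟨_, hF 0⟩
  obtain ⟨f, hf, hfN⟩ := exists_mem_forall_inner_eq_zero
    (isClosed_condDensities (c := c) (P := P) hm hn) (convex_condDensities hm)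
    (fun _ => norm_le_of_mem_condDensities) N (by
      rintro v ⟨φ, hφ⟩
      have hfib : ∀ a, MeasurableSet[m] (φ ⁻¹' {a}) := fun a =>
        @SimpleFunc.measurableSet_fiber _ _ m φ a
      -- On each fibre `φ = a` the density `F a` that is good for `a` is used; the fibrewise
      -- contributions are nonnegative and add up.
      obtain ⟨h, hh, hR⟩ := exists_mem_condDensities_paste_finset hm hmn φ hfib F hF hne
        (@SimpleFunc.range _ _ m φ)
      refine ⟨h, hh, ?_⟩
      have hcov : (⋃ a ∈ @SimpleFunc.range _ _ m φ, φ ⁻¹' {a}) = Set.univ := by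
        ext ω
        simp
      have hint : Integrable (fun ω => h ω * v ω) P := (Lp.memLp h).integrable_mul (Lp.memLp v)
      have hinner : inner ℝ v h = ∫ ω, h ω * v ω ∂P := by
        rw [L2.inner_def]; simp
      rw [hinner, ← setIntegral_univ, ← hcov, integral_biUnion_finset _ (fun a _ => hm _ (hfib a))
        (fun a _ b _ hab => (Set.disjoint_singleton.2 hab).preimage φ)
        (fun a _ => hint.integrableOn)]
      refine Finset.sum_nonneg fun a ha => ?_
      rw [setIntegral_congr_ae (g := fun ω => F a ω * y a ω) (hm _ (hfib a))]
      · exact hF0 a _ (hfib a)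
      · filter_upwards [hR a ha, hφ] with ω h1 h2 (hωa : φ ω = a)
        rw [h1 hωa, h2, hωa])
  refine ⟨f, hf, fun a A hA => ?_⟩
  have hLp : MemLp (A.indicator (y a)) 2 P := (memLp_two_of_Linf (y a)).indicator (hm A hA)
  -- The mixture equal to `a` on `A` and to zero elsewhere recovers the integral over `A`.
  have h1 := hfN (hLp.toLp _) ⟨@SimpleFunc.piecewise _ _ m A hA (@SimpleFunc.const _ _ m a)
    (@SimpleFunc.const _ _ m 0), by
      filter_upwards [hLp.coeFn_toLp] with ω h1
      rw [h1, @SimpleFunc.piecewise_apply _ _ m]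
      by_cases hω : ω ∈ A
      · simp [hω]
      · simp [hω]⟩
  rw [inner_toLp_eq_integral] at h1
  rw [← h1, ← integral_indicator (hm A hA)]
  congr 1 with ω
  by_cases hω : ω ∈ A <;> simp [hω]

end ConditionalDensities

/-! ### The measures in `Q_st` as conditional densities, and the bounds `m_st`, `M_st`. -/

section BoundedDensityMeasures

open NoGoodDeal

theorem abs_coeFn_le_norm_Linf {Ω : Type*} {mΩ : MeasurableSpace Ω} {P : Measure Ω}
    (X : Lp ℝ ∞ P) : ∀ᵐ ω ∂P, |X ω| ≤ ‖X‖ := by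
  have h := ae_le_eLpNormEssSup (f := X) (μ := P)
  filter_upwards [h] with ω hω
  rw [Lp.norm_def, eLpNorm_exponent_top, ← Real.norm_eq_abs, ← toReal_enorm]
  refine ENNReal.toReal_mono ?_ hω
  rw [← eLpNorm_exponent_top]
  exact (Lp.memLp X).2.ne

variable {Ω : Type*} {m n mΩ : MeasurableSpace Ω} {P : Measure Ω} [IsProbabilityMeasure P] {c : ℝ}

theorem condExp_eq_one_of_mem_condDensities (hm : m ≤ mΩ) {f : Lp ℝ 2 P}
    (hf : f ∈ condDensities P m n c) : P[f | m] =ᵐ[P] fun _ => 1 := by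
  have h := condExp_eq_condExp_of_forall_setIntegral_eq hm (f := f) (g := fun _ => (1 : ℝ))
    ((Lp.memLp f).integrable one_le_two) (integrable_const 1) (fun A hA => by
      rw [hf.2.2.1 A hA]; simp)
  rwa [condExp_const hm] at h

/-- Bayes' formula, whose denominator `P[f | m]` is here equal to one. -/
theorem condExp_withDensity_of_mem_condDensities (hm : m ≤ mΩ) {f : Lp ℝ 2 P}
    (hf : f ∈ condDensities P m n c) (X : Lp ℝ ∞ P) :
    (P.withDensity fun ω => ENNReal.ofReal (f ω))[X | m] =ᵐ[P] P[fun ω => f ω * X ω | m] := by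
  filter_upwards [condExp_mul_eq_condExp_withDensity hm ((Lp.memLp f).integrable one_le_two)
    ((Lp.coeFn_nonneg f).2 hf.1) (integrable_mul_Linf (Lp.memLp f) X),
    condExp_eq_one_of_mem_condDensities hm hf] with ω h1 h2
  rw [h1, h2, one_mul]

theorem condExp_mul_const_of_mem_condDensities (hm : m ≤ mΩ) {f : Lp ℝ 2 P}
    (hf : f ∈ condDensities P m n c) (r : ℝ) : P[fun ω => f ω * r | m] =ᵐ[P] fun _ => r := by
  have h2 : (fun ω => f ω * r) = r • (f : Ω → ℝ) := by
    ext ω; simp [mul_comm]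
  rw [h2]
  filter_upwards [condExp_smul (μ := P) r f m, condExp_eq_one_of_mem_condDensities hm hf]
    with ω h3 h4
  rw [h3, Pi.smul_apply, h4, smul_eq_mul, mul_one]

theorem abs_condExp_mul_le_norm (hm : m ≤ mΩ) {f : Lp ℝ 2 P}
    (hf : f ∈ condDensities P m n c) (X : Lp ℝ ∞ P) :
    ∀ᵐ ω ∂P, |(P[fun ω => f ω * X ω | m]) ω| ≤ ‖X‖ := by
  have hi := integrable_mul_Linf (Lp.memLp f) X
  have hi' : Integrable (fun ω => f ω * ‖X‖) P :=
    ((Lp.memLp f).integrable one_le_two).mul_const _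
  have h0 := condExp_mul_const_of_mem_condDensities hm hf ‖X‖
  have hb : ∀ᵐ ω ∂P, |f ω * X ω| ≤ f ω * ‖X‖ := by
    filter_upwards [abs_coeFn_le_norm_Linf X, (Lp.coeFn_nonneg f).2 hf.1] with ω h1 h2
    rw [abs_mul, abs_of_nonneg h2]
    exact mul_le_mul_of_nonneg_left h1 h2
  have h1 := condExp_mono (m := m) hi hi' (hb.mono fun ω h => (abs_le.1 h).2)
  have h2 := condExp_mono (m := m) hi'.neg hi (hb.mono fun ω h => (abs_le.1 h).1)
  filter_upwards [h0, h1, h2, condExp_neg (μ := P) (fun ω => f ω * ‖X‖) m] with ω h0 h1 h2 h3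
  rw [h3, Pi.neg_apply, h0] at h2
  rw [h0] at h1
  exact abs_le.2 ⟨h2, h1⟩

theorem one_mem_condDensities (hc : 1 ≤ c) : Lp.const 2 P (1 : ℝ) ∈ condDensities P m n c := by
  have h1 := Lp.coeFn_const (p := 2) (μ := P) (1 : ℝ)
  refine ⟨?_, ?_, fun A _ => ?_, fun A _ => ?_⟩
  · rw [← Lp.coeFn_nonneg]
    filter_upwards [h1] with ω h
    rw [h]
    exact zero_le_one
  · exact (aestronglyMeasurable_const (b := (1 : ℝ))).congr h1.symm
  · rw [integral_congr_ae (ae_restrict_of_ae h1)]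
    simp
  · rw [integral_congr_ae (g := fun _ => (1 : ℝ)) (ae_restrict_of_ae (h1.mono fun ω h => by
        simp only [h, Function.const_apply, one_pow]))]
    simpa using le_mul_of_one_le_left measureReal_nonneg hc

variable {T : ℝ} {F : Filtration (Set.Icc (0 : ℝ) T) mΩ}
  {δ : Set.Icc (0 : ℝ) T → Set.Icc (0 : ℝ) T → ℝ} {s t : Set.Icc (0 : ℝ) T}

theorem setIntegral_sub_one_sq {f : Ω → ℝ} (hf : MemLp f 2 P) (A : Set Ω) :
    ∫ ω in A, (f ω - 1) ^ 2 ∂P =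
      ∫ ω in A, f ω ^ 2 ∂P - 2 * ∫ ω in A, f ω ∂P + P.real A := by
  have h1 : ∀ ω, (f ω - 1) ^ 2 = f ω ^ 2 - 2 * f ω + 1 := fun ω => by ring
  simp only [h1]
  have hi1 := hf.integrable_sq.integrableOn (s := A)
  have hi2 := ((hf.integrable one_le_two).const_mul 2).integrableOn (s := A)
  have hi3 : IntegrableOn (fun ω => f ω ^ 2 - 2 * f ω) A P := hi1.sub hi2
  rw [integral_add hi3 (integrable_const _), integral_sub hi1 hi2, integral_const_mul]
  simp

/-- With `f = 1 + g` and conditional mean one, `E[f² | F_s] = 1 + E[g² | F_s]`; this is why the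
constant `δ²` becomes `1 + δ²`. -/
theorem boundedDensityMeasures_eq_image : boundedDensityMeasures P F δ s t =
    (fun f : Lp ℝ 2 P => P.withDensity fun ω => ENNReal.ofReal (f ω)) ''
      condDensities P (F s) (F t) (1 + δ s t ^ 2) := by
  ext Q
  constructor
  · rintro ⟨hQ, hac, htrim, g, hg, hgL, hgQ, hg2⟩
    have h1L : MemLp (fun _ : Ω => (1 : ℝ)) 2 P := memLp_const 1
    have hL : MemLp (fun ω => 1 + g ω) 2 P := h1L.add hgL
    obtain ⟨f, hfg⟩ : ∃ f : Lp ℝ 2 P, f =ᵐ[P] fun ω => 1 + g ω := ⟨hL.toLp _, hL.coeFn_toLp⟩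
    have hcoe : ∀ᵐ ω ∂P, f ω = (Q.rnDeriv P ω).toReal := by
      filter_upwards [hfg, hgQ] with ω h1 h2
      rw [h1, ← h2]
    have hQeq : (P.withDensity fun ω => ENNReal.ofReal (f ω)) = Q := by
      rw [← Measure.withDensity_rnDeriv_eq Q P hac]
      refine withDensity_congr_ae ?_
      filter_upwards [hcoe, Q.rnDeriv_lt_top P] with ω h1 h2
      rw [h1, ENNReal.ofReal_toReal h2.ne]
    have hA1 : ∀ A, MeasurableSet[F s] A → ∫ ω in A, (1 + g ω) ∂P = P.real A := by
      intro A hA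
      rw [integral_congr_ae (ae_restrict_of_ae (hgQ.symm)),
        Measure.setIntegral_toReal_rnDeriv hac, measureReal_def, measureReal_def,
        ← trim_measurableSet_eq (F.le s) hA, htrim, trim_measurableSet_eq (F.le s) hA]
    refine ⟨f, ⟨?_, ?_, fun A hA => ?_, fun A hA => ?_⟩, hQeq⟩
    · rw [← Lp.coeFn_nonneg]
      filter_upwards [hcoe] with ω h
      rw [h]
      exact ENNReal.toReal_nonneg
    · have h0 : StronglyMeasurable[F t] fun ω => 1 + g ω := stronglyMeasurable_const.add hg
      exact h0.aestronglyMeasurable.congr hfg.symm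
    · rw [integral_congr_ae (ae_restrict_of_ae hfg), hA1 A hA]
    · rw [integral_congr_ae (g := fun ω => (1 + g ω) ^ 2)
        (ae_restrict_of_ae (hfg.mono fun ω h => by simp [h]))]
      have h1 := setIntegral_le_of_condExp_le (F.le s) (g := fun _ => δ s t ^ 2) hgL.integrable_sq
        (integrable_const _) (by rw [condExp_const (F.le s)]; exact hg2) hA
      have h2 := setIntegral_sub_one_sq hL A
      simp only [add_sub_cancel_left] at h2
      rw [hA1 A hA] at h2
      rw [setIntegral_const, smul_eq_mul] at h1
      linarith
  · rintro ⟨f, hf, rfl⟩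
    have hfi : Integrable f P := (Lp.memLp f).integrable one_le_two
    have hf0 := (Lp.coeFn_nonneg f).2 hf.1
    have hmeas : AEMeasurable (fun ω => ENNReal.ofReal (f ω)) P := hfi.1.aemeasurable.ennreal_ofReal
    have hset : ∀ A, MeasurableSet[F s] A →
        (P.withDensity fun ω => ENNReal.ofReal (f ω)) A = P A := by
      intro A hA
      rw [withDensity_apply _ (F.le s _ hA), ← ofReal_integral_eq_lintegral_ofReal hfi.integrableOn
        (ae_restrict_of_ae hf0), hf.2.2.1 A hA, ofReal_measureReal]
    obtain ⟨k, hk, hfk⟩ := hf.2.1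
    have hkL : MemLp k 2 P := (memLp_congr_ae hfk).1 (Lp.memLp f)
    have hrn := Measure.rnDeriv_withDensity₀ P hmeas
    refine ⟨⟨?_⟩, withDensity_absolutelyContinuous _ _, ?_, fun ω => k ω - 1,
      hk.sub stronglyMeasurable_const, hkL.sub (memLp_const 1), ?_, ?_⟩
    · rw [hset _ MeasurableSet.univ, measure_univ]
    · refine @Measure.ext _ (F s) _ _ fun A hA => ?_
      rw [trim_measurableSet_eq _ hA, trim_measurableSet_eq _ hA, hset A hA]
    · filter_upwards [hrn, hfk, hf0] with ω h1 h2 h3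
      rw [h1, ENNReal.toReal_ofReal h3, h2]
      ring
    · have h := condExp_le_condExp_of_forall_setIntegral_le (P := P) (F.le s)
        (f := fun ω => (k ω - 1) ^ 2) (g := fun _ => δ s t ^ 2)
        (hkL.sub (memLp_const 1)).integrable_sq (integrable_const _) (fun A hA => by
          have h1 := hf.2.2.1 A hA
          have h2 := hf.2.2.2 A hA
          rw [integral_congr_ae (ae_restrict_of_ae hfk)] at h1
          rw [integral_congr_ae (g := fun ω => k ω ^ 2)
            (ae_restrict_of_ae (hfk.mono fun ω h => by simp [h]))] at h2
          rw [setIntegral_sub_one_sq hkL, h1, setIntegral_const, smul_eq_mul]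
          linarith)
      rwa [condExp_const (F.le s)] at h

theorem condExpClass_image_eq (X : Lp ℝ ∞ P) :
    (fun Q => condExpClass P Q F s X) '' boundedDensityMeasures P F δ s t =
      (fun f : Lp ℝ 2 P => AEEqFun.mk (P[fun ω => f ω * X ω | F s])
        (stronglyMeasurable_condExp.mono (F.le s)).aestronglyMeasurable) ''
        condDensities P (F s) (F t) (1 + δ s t ^ 2) := by
  rw [boundedDensityMeasures_eq_image, Set.image_image]
  refine Set.image_congr fun f hf => ?_
  exact AEEqFun.mk_eq_mk.2 (condExp_withDensity_of_mem_condDensities (F.le s) hf X)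

/-- The family contains the value under the constant density one and is bounded by `‖X‖`, so the
essential supremum is a genuine least upper bound and not the junk value. -/
theorem isLUB_upperBound (X : Lp ℝ ∞ P) :
    IsLUB ((fun f : Lp ℝ 2 P => (AEEqFun.mk (P[fun ω => f ω * X ω | F s])
        (stronglyMeasurable_condExp.mono (F.le s)).aestronglyMeasurable : Ω →ₘ[P] ℝ)) ''
        condDensities P (F s) (F t) (1 + δ s t ^ 2)) (upperBound P F δ s t X) := by
  rw [upperBound, ← condExpClass_image_eq]
  refine isLUB_essSupFamily ?_ ?_ <;> rw [condExpClass_image_eq]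
  · exact Set.Nonempty.image _ ⟨_, one_mem_condDensities (by nlinarith [sq_nonneg (δ s t)])⟩
  · refine ⟨AEEqFun.const Ω ‖X‖, ?_⟩
    rintro _ ⟨f, hf, rfl⟩
    rw [← AEEqFun.coeFn_le]
    filter_upwards [abs_condExp_mul_le_norm (F.le s) hf X, AEEqFun.coeFn_const (μ := P) Ω ‖X‖,
      AEEqFun.coeFn_mk (μ := P) (P[fun ω => f ω * X ω | F s])
        (stronglyMeasurable_condExp.mono (F.le s)).aestronglyMeasurable] with ω h1 h2 h3
    rw [h2, h3]
    exact (abs_le.1 h1).2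

theorem isGLB_lowerBound (X : Lp ℝ ∞ P) :
    IsGLB ((fun f : Lp ℝ 2 P => (AEEqFun.mk (P[fun ω => f ω * X ω | F s])
        (stronglyMeasurable_condExp.mono (F.le s)).aestronglyMeasurable : Ω →ₘ[P] ℝ)) ''
        condDensities P (F s) (F t) (1 + δ s t ^ 2)) (lowerBound P F δ s t X) := by
  rw [lowerBound, ← condExpClass_image_eq]
  refine isGLB_essInfFamily ?_ ?_ <;> rw [condExpClass_image_eq]
  · exact Set.Nonempty.image _ ⟨_, one_mem_condDensities (by nlinarith [sq_nonneg (δ s t)])⟩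
  · refine ⟨AEEqFun.const Ω (-‖X‖), ?_⟩
    rintro _ ⟨f, hf, rfl⟩
    rw [← AEEqFun.coeFn_le]
    filter_upwards [abs_condExp_mul_le_norm (F.le s) hf X, AEEqFun.coeFn_const (μ := P) Ω (-‖X‖),
      AEEqFun.coeFn_mk (μ := P) (P[fun ω => f ω * X ω | F s])
        (stronglyMeasurable_condExp.mono (F.le s)).aestronglyMeasurable] with ω h1 h2 h3
    rw [h2, h3]
    exact (abs_le.1 h1).1

end BoundedDensityMeasures

/-! ### One-period representation of prices. -/

section OnePeriod

open NoGoodDeal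

variable {Ω : Type*} {mΩ : MeasurableSpace Ω} {P : Measure Ω} [IsProbabilityMeasure P]
  {T : ℝ} {F : Filtration (Set.Icc (0 : ℝ) T) mΩ}
  {δ : Set.Icc (0 : ℝ) T → Set.Icc (0 : ℝ) T → ℝ} {s t : Set.Icc (0 : ℝ) T}

theorem Lp_const_mem_Linf (r : ℝ) : Lp.const ∞ P r ∈ Linf P F t := by
  rw [mem_lpMeas_iff_aestronglyMeasurable]
  exact (aestronglyMeasurable_const (b := r)).congr (Lp.coeFn_const (p := ∞) (μ := P) r).symm

variable {D E : Submodule ℝ (Lp ℝ ∞ P)}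

theorem NoGoodDeal.IsPriceOperator.map_neg {x : D → E} (hx : IsPriceOperator P F s x) (X : D) :
    x (-X) = -x X := by
  have h0 : x 0 = 0 := by simpa using hx.additive 0 0
  have h := hx.additive (-X) X
  rw [neg_add_cancel, h0] at h
  exact eq_neg_of_add_eq_zero_left h.symm

theorem NoGoodDeal.IsPriceOperator.map_smul {x : D → E} (hx : IsPriceOperator P F s x) (r : ℝ)
    (X : D) : x (r • X) = r • x X := by
  have hpos : ∀ r : ℝ, 0 ≤ r → x (r • X) = r • x X := by
    intro r hr
    have hc := Lp.coeFn_const (p := ∞) (μ := P) r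
    have h := hx.homogeneous (Lp.const ∞ P r) (Lp_const_mem_Linf r)
      (by
        rw [← Lp.coeFn_nonneg]
        filter_upwards [hc] with ω h
        rw [h]; exact hr) X (r • X) (by
        filter_upwards [hc, Lp.coeFn_smul r (X : Lp ℝ ∞ P)] with ω h1 h2
        rw [h1, Submodule.coe_smul, h2]; rfl)
    refine Subtype.ext (Lp.ext ?_)
    filter_upwards [h, hc, Lp.coeFn_smul r (x X : Lp ℝ ∞ P)] with ω h1 h2 h3
    rw [h1, h2, Submodule.coe_smul, h3]; rfl
  rcases le_total 0 r with hr | hr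
  · exact hpos r hr
  · have h := hpos (-r) (neg_nonneg.2 hr)
    rw [neg_smul, neg_smul, hx.map_neg] at h
    exact neg_injective h

/-- A price operator as a linear map. -/
def NoGoodDeal.IsPriceOperator.toLinearMap {x : D → E} (hx : IsPriceOperator P F s x) :
    D →ₗ[ℝ] E where
  toFun := x
  map_add' := hx.additive
  map_smul' := hx.map_smul

/-- Under the sandwich condition the price of a claim is dominated by its conditional value under
some conditional density. -/
theorem exists_mem_condDensities_le_condExp (hst : s ≤ t) (hD : D ≤ Linf P F t) {x : D → E}
    (hsand : ∀ X : D, ∀ Y ∈ Linf P F t, ∀ Z ∈ Linf P F t, 0 ≤ Y → 0 ≤ Z →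
      Z + (X : Lp ℝ ∞ P) ≤ Y → lowerBound P F δ s t Z + ((x X : Lp ℝ ∞ P) : Ω →ₘ[P] ℝ)
        ≤ upperBound P F δ s t Y) (X : D) :
    ∃ f ∈ condDensities P (F s) (F t) (1 + δ s t ^ 2),
      (x X : Lp ℝ ∞ P) ≤ᵐ[P] P[fun ω => f ω * (X : Lp ℝ ∞ P) ω | F s] := by
  have hne : (condDensities P (F s) (F t) (1 + δ s t ^ 2)).Nonempty :=
    ⟨_, one_mem_condDensities (by nlinarith [sq_nonneg (δ s t)])⟩
  obtain ⟨f, hf, hmax⟩ := exists_forall_condExp_mul_le (F.le s) (F.le t) (F.mono hst) hne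
    (X : Lp ℝ ∞ P)
  refine ⟨f, hf, ?_⟩
  -- The sandwich condition speaks of nonnegative claims only. The constant `Z = r` and `Y = X + Z`
  -- are both nonnegative, and `r` cancels at the end.
  set r := ‖(X : Lp ℝ ∞ P)‖ with hr
  set Z := Lp.const ∞ P r with hZ
  have hZr : ∀ᵐ ω ∂P, Z ω = r := Lp.coeFn_const (p := ∞) (μ := P) r
  have hYr : ∀ᵐ ω ∂P, ((X : Lp ℝ ∞ P) + Z : Lp ℝ ∞ P) ω = (X : Lp ℝ ∞ P) ω + r := by
    filter_upwards [hZr, Lp.coeFn_add (X : Lp ℝ ∞ P) Z] with ω h1 h2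
    rw [h2, Pi.add_apply, h1]
  have hZ0 : 0 ≤ Z := by
    rw [← Lp.coeFn_nonneg]
    filter_upwards [hZr] with ω h
    rw [h]; exact norm_nonneg _
  have hY0 : 0 ≤ (X : Lp ℝ ∞ P) + Z := by
    rw [← Lp.coeFn_nonneg]
    filter_upwards [hYr, abs_coeFn_le_norm_Linf (X : Lp ℝ ∞ P)] with ω h1 h2
    rw [h1, Pi.zero_apply]
    linarith [(abs_le.1 h2).1]
  have h := hsand X _ (add_mem (hD X.2) (Lp_const_mem_Linf r)) Z (Lp_const_mem_Linf r) hY0 hZ0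
    (by rw [add_comm])
  have hlow : AEEqFun.const Ω r ≤ lowerBound P F δ s t Z := by
    refine (isGLB_lowerBound Z).2 ?_
    rintro _ ⟨g, hg, rfl⟩
    rw [← AEEqFun.coeFn_le]
    have h1 : P[fun ω => g ω * Z ω | F s] =ᵐ[P] P[fun ω => g ω * r | F s] :=
      condExp_congr_ae (hZr.mono fun ω h => by simp only [h])
    filter_upwards [AEEqFun.coeFn_const (μ := P) Ω r,
      AEEqFun.coeFn_mk (μ := P) (P[fun ω => g ω * Z ω | F s])
        (stronglyMeasurable_condExp.mono (F.le s)).aestronglyMeasurable, h1,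
      condExp_mul_const_of_mem_condDensities (F.le s) hg r] with ω h2 h3 h4 h5
    rw [h2, h3, h4, h5]; rfl
  have hup : upperBound P F δ s t ((X : Lp ℝ ∞ P) + Z) ≤
      AEEqFun.mk (P[fun ω => f ω * (X : Lp ℝ ∞ P) ω | F s])
        (stronglyMeasurable_condExp.mono (F.le s)).aestronglyMeasurable + AEEqFun.const Ω r := by
    refine (isLUB_upperBound _).2 ?_
    rintro _ ⟨g, hg, rfl⟩
    rw [← AEEqFun.coeFn_le]
    have h1 : P[fun ω => g ω * ((X : Lp ℝ ∞ P) + Z : Lp ℝ ∞ P) ω | F s] =ᵐ[P]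
        P[(fun ω => g ω * (X : Lp ℝ ∞ P) ω) + fun ω => g ω * r | F s] :=
      condExp_congr_ae (hYr.mono fun ω h => by simp only [h, Pi.add_apply, mul_add])
    have h2 := condExp_add (integrable_mul_Linf (Lp.memLp g) (X : Lp ℝ ∞ P))
      (((Lp.memLp g).integrable one_le_two).mul_const r) (F s)
    filter_upwards [AEEqFun.coeFn_const (μ := P) Ω r, AEEqFun.coeFn_add
      (AEEqFun.mk (P[fun ω => f ω * (X : Lp ℝ ∞ P) ω | F s])
        (stronglyMeasurable_condExp.mono (F.le s)).aestronglyMeasurable) (AEEqFun.const Ω r),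
      AEEqFun.coeFn_mk (μ := P) (P[fun ω => f ω * (X : Lp ℝ ∞ P) ω | F s])
        (stronglyMeasurable_condExp.mono (F.le s)).aestronglyMeasurable,
      AEEqFun.coeFn_mk (μ := P) (P[fun ω => g ω * ((X : Lp ℝ ∞ P) + Z : Lp ℝ ∞ P) ω | F s])
        (stronglyMeasurable_condExp.mono (F.le s)).aestronglyMeasurable, h1, h2,
      condExp_mul_const_of_mem_condDensities (F.le s) hg r, hmax g hg]
      with ω h3 h4 h5 h6 h7 h8 h9 h10
    rw [h4, Pi.add_apply, h3, h5, h6, h7, h8, Pi.add_apply, h9]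
    exact add_le_add_left h10 r
  filter_upwards [AEEqFun.coeFn_le.2 h, AEEqFun.coeFn_le.2 hlow, AEEqFun.coeFn_le.2 hup,
    AEEqFun.coeFn_add (lowerBound P F δ s t Z) ((x X : Lp ℝ ∞ P) : Ω →ₘ[P] ℝ),
    AEEqFun.coeFn_const (μ := P) Ω r, AEEqFun.coeFn_add
      (AEEqFun.mk (P[fun ω => f ω * (X : Lp ℝ ∞ P) ω | F s])
        (stronglyMeasurable_condExp.mono (F.le s)).aestronglyMeasurable) (AEEqFun.const Ω r),
      AEEqFun.coeFn_mk (μ := P) (P[fun ω => f ω * (X : Lp ℝ ∞ P) ω | F s])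
        (stronglyMeasurable_condExp.mono (F.le s)).aestronglyMeasurable]
    with ω h1 h2 h3 h4 h5 h6 h7
  rw [h4, Pi.add_apply] at h1
  rw [h6, Pi.add_apply, h5, h7, Function.const_apply] at h3
  rw [h5, Function.const_apply] at h2
  linarith

/-- One-period extension: a price operator satisfying the sandwich condition is represented by a
conditional density. -/
theorem exists_mem_condDensities_forall_condExp_eq (hst : s ≤ t) (hD : D ≤ Linf P F t)
    (hE : E ≤ Linf P F s) {x : D → E} (hx : IsPriceOperator P F s x)
    (hsand : ∀ X : D, ∀ Y ∈ Linf P F t, ∀ Z ∈ Linf P F t, 0 ≤ Y → 0 ≤ Z →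
      Z + (X : Lp ℝ ∞ P) ≤ Y → lowerBound P F δ s t Z + ((x X : Lp ℝ ∞ P) : Ω →ₘ[P] ℝ)
        ≤ upperBound P F δ s t Y) :
    ∃ f ∈ condDensities P (F s) (F t) (1 + δ s t ^ 2), ∀ X : D,
      P[fun ω => f ω * (X : Lp ℝ ∞ P) ω | F s] =ᵐ[P] (x X : Lp ℝ ∞ P) := by
  have hmeas : ∀ X : D, AEStronglyMeasurable[F s] (x X : Lp ℝ ∞ P) P := fun X =>
    mem_lpMeas_iff_aestronglyMeasurable.1 (hE (x X).2)
  have hint : ∀ (f : Lp ℝ 2 P) (X : Lp ℝ ∞ P), Integrable (fun ω => f ω * X ω) P := fun f X =>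
    integrable_mul_Linf (Lp.memLp f) X
  -- prices are `F_s`-measurable, hence can be pulled out
  have hpull : ∀ f ∈ condDensities P (F s) (F t) (1 + δ s t ^ 2), ∀ X : D,
      P[fun ω => f ω * (x X : Lp ℝ ∞ P) ω | F s] =ᵐ[P] (x X : Lp ℝ ∞ P) := by
    intro f hf X
    have h := condExp_mul_of_aestronglyMeasurable_right (hmeas X) (hint f (x X))
      ((Lp.memLp f).integrable one_le_two)
    filter_upwards [h, condExp_eq_one_of_mem_condDensities (F.le s) hf] with ω h1 h2
    refine h1.trans ?_
    rw [Pi.mul_apply, h2, one_mul]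
  -- The gain from buying a claim at its price; a density represents the prices exactly when all
  -- gains have conditional value zero.
  let y : D →ₗ[ℝ] Lp ℝ ∞ P := D.subtype - E.subtype ∘ₗ hx.toLinearMap
  have hy : ∀ (f : Lp ℝ 2 P) (X : D) A, ∫ ω in A, f ω * y X ω ∂P =
      ∫ ω in A, f ω * (X : Lp ℝ ∞ P) ω ∂P - ∫ ω in A, f ω * (x X : Lp ℝ ∞ P) ω ∂P := by
    intro f X A
    rw [← integral_sub (hint f X).integrableOn (hint f (x X)).integrableOn]
    refine integral_congr_ae (ae_restrict_of_ae ?_)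
    filter_upwards [Lp.coeFn_sub (X : Lp ℝ ∞ P) (x X : Lp ℝ ∞ P)] with ω h
    have h' : y X ω = ((X : Lp ℝ ∞ P) - (x X : Lp ℝ ∞ P) : Lp ℝ ∞ P) ω := rfl
    rw [h', h, Pi.sub_apply, mul_sub]
  obtain ⟨f, hf, h0⟩ := exists_mem_condDensities_forall_setIntegral_eq_zero
    (c := 1 + δ s t ^ 2) (F.le s) (F.le t) (F.mono hst) y (fun X => by
      obtain ⟨f, hf, hle⟩ := exists_mem_condDensities_le_condExp hst hD hsand X
      refine ⟨f, hf, fun A hA => ?_⟩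
      rw [hy, sub_nonneg]
      exact setIntegral_le_of_condExp_le (F.le s) (hint f (x X)) (hint f X)
        ((hpull f hf X).le.trans hle) hA)
  refine ⟨f, hf, fun X => ?_⟩
  refine (condExp_eq_condExp_of_forall_setIntegral_eq (F.le s) (hint f X) (hint f (x X))
    fun A hA => ?_).trans (hpull f hf X)
  rw [← sub_eq_zero, ← hy, h0 X A hA]

end OnePeriod

/-! ### Second-moment constraints between two σ-algebras form closed convex sets. -/

section Dynamic

open NoGoodDeal

variable {Ω : Type*} {mΩ : MeasurableSpace Ω} {P : Measure Ω}

/-- The conditional Cauchy-Schwarz inequality. -/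
theorem sq_condExp_mul_le {m : MeasurableSpace Ω} {v w : Ω → ℝ} (hv : MemLp v 2 P)
    (hw : MemLp w 2 P) : ∀ᵐ ω ∂P, (P[fun ω => v ω * w ω | m]) ω ^ 2 ≤
      (P[fun ω => v ω ^ 2 | m]) ω * (P[fun ω => w ω ^ 2 | m]) ω := by
  have hvw : Integrable (fun ω => v ω * w ω) P := hv.integrable_mul hw
  -- The conditional expectation of `(q v + w)²`, as a quadratic in `q`. Rational `q` keeps the
  -- exceptional sets countable in number; density extends to the reals, where the discriminant is
  -- nonpositive.
  have key : ∀ᵐ ω ∂P, ∀ q : ℚ, 0 ≤ (P[fun ω => v ω ^ 2 | m]) ω * ((q : ℝ) * q) +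
      (2 * (P[fun ω => v ω * w ω | m]) ω) * q + (P[fun ω => w ω ^ 2 | m]) ω := by
    refine ae_all_iff.2 fun q => ?_
    have hi1 : Integrable (((q : ℝ) ^ 2) • fun ω => v ω ^ 2) P := hv.integrable_sq.smul _
    have hi2 : Integrable ((2 * (q : ℝ)) • fun ω => v ω * w ω) P := hvw.smul _
    have h0 : 0 ≤ᵐ[P] P[((q : ℝ) ^ 2 • fun ω => v ω ^ 2) + ((2 * (q : ℝ)) • fun ω => v ω * w ω) +
        fun ω => w ω ^ 2 | m] := by
      refine condExp_nonneg (Eventually.of_forall fun ω => ?_)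
      have : 0 ≤ ((q : ℝ) * v ω + w ω) ^ 2 := sq_nonneg _
      simp only [Pi.zero_apply, Pi.add_apply, Pi.smul_apply, smul_eq_mul]
      linarith
    filter_upwards [h0, condExp_add (hi1.add hi2) hw.integrable_sq m, condExp_add hi1 hi2 m,
      condExp_smul (μ := P) ((q : ℝ) ^ 2) (fun ω => v ω ^ 2) m,
      condExp_smul (μ := P) (2 * (q : ℝ)) (fun ω => v ω * w ω) m] with ω h0 h1 h2 h3 h4
    rw [h1, Pi.add_apply, h2, Pi.add_apply, h3, h4] at h0
    simp only [Pi.zero_apply, Pi.smul_apply, smul_eq_mul] at h0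
    linarith
  filter_upwards [key] with ω hω
  have hall : ∀ r : ℝ, 0 ≤ (P[fun ω => v ω ^ 2 | m]) ω * (r * r) +
      (2 * (P[fun ω => v ω * w ω | m]) ω) * r + (P[fun ω => w ω ^ 2 | m]) ω := by
    intro r
    refine Rat.isDenseEmbedding_coe_real.dense.induction_on (p := fun r : ℝ =>
      0 ≤ (P[fun ω => v ω ^ 2 | m]) ω * (r * r) +
      (2 * (P[fun ω => v ω * w ω | m]) ω) * r + (P[fun ω => w ω ^ 2 | m]) ω) r
      (isClosed_le continuous_const (by fun_prop)) hω
  have h := discrim_le_zero hall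
  rw [discrim] at h
  linarith

variable [IsProbabilityMeasure P]

/-- Conditional Cauchy-Schwarz bounds `E[v w | m]²` by `(c a b)²`, and the signs of `a` and `b`
allow the root to be taken. This controls the cross term in `convex_relDensities`. -/
theorem setIntegral_mul_le_of_forall_setIntegral_sq_le {m : MeasurableSpace Ω} (hm : m ≤ mΩ)
    {v w a b : Ω → ℝ} {c : ℝ} (hc : 0 ≤ c) (hv : MemLp v 2 P) (hw : MemLp w 2 P) (ha : MemLp a 2 P)
    (hb : MemLp b 2 P) (ham : StronglyMeasurable[m] a) (hbm : StronglyMeasurable[m] b)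
    (ha0 : 0 ≤ᵐ[P] a) (hb0 : 0 ≤ᵐ[P] b)
    (hva : ∀ A, MeasurableSet[m] A → ∫ ω in A, v ω ^ 2 ∂P ≤ c * ∫ ω in A, a ω ^ 2 ∂P)
    (hwb : ∀ A, MeasurableSet[m] A → ∫ ω in A, w ω ^ 2 ∂P ≤ c * ∫ ω in A, b ω ^ 2 ∂P)
    {A : Set Ω} (hA : MeasurableSet[m] A) :
    ∫ ω in A, v ω * w ω ∂P ≤ c * ∫ ω in A, a ω * b ω ∂P := by
  have hab : Integrable (fun ω => c * (a ω * b ω)) P := (ha.integrable_mul hb).const_mul c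
  have hsq : ∀ {v a : Ω → ℝ}, MemLp v 2 P → MemLp a 2 P → StronglyMeasurable[m] a →
      (∀ A, MeasurableSet[m] A → ∫ ω in A, v ω ^ 2 ∂P ≤ c * ∫ ω in A, a ω ^ 2 ∂P) →
      ∀ᵐ ω ∂P, (P[fun ω => v ω ^ 2 | m]) ω ≤ c * a ω ^ 2 := by
    intro v a hv ha ham h
    have hi : Integrable (fun ω => c * a ω ^ 2) P := ha.integrable_sq.const_mul c
    have h1 := condExp_le_condExp_of_forall_setIntegral_le hm hv.integrable_sq hi
      (fun A hA => by rw [integral_const_mul]; exact h A hA)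
    have hs : StronglyMeasurable[m] fun ω => c * a ω ^ 2 :=
      stronglyMeasurable_const.mul (ham.pow 2)
    rwa [condExp_of_stronglyMeasurable hm hs hi] at h1
  rw [← integral_const_mul]
  refine setIntegral_le_of_condExp_le hm (hv.integrable_mul hw) hab ?_ hA
  have hs : StronglyMeasurable[m] fun ω => c * (a ω * b ω) :=
    stronglyMeasurable_const.mul (ham.mul hbm)
  rw [condExp_of_stronglyMeasurable hm hs hab]
  have hv0 : 0 ≤ᵐ[P] P[fun ω => v ω ^ 2 | m] :=
    condExp_nonneg (Eventually.of_forall fun ω => sq_nonneg _)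
  have hw0 : 0 ≤ᵐ[P] P[fun ω => w ω ^ 2 | m] :=
    condExp_nonneg (Eventually.of_forall fun ω => sq_nonneg _)
  filter_upwards [sq_condExp_mul_le hv hw (m := m), hsq hv ha ham hva, hsq hw hb hbm hwb, ha0, hb0,
    hv0, hw0] with ω h1 h2 h3 h4 h5 h6 h7
  refine le_of_sq_le_sq (h1.trans ((mul_le_mul h2 h3 h7 (h6.trans h2)).trans_eq ?_))
    (mul_nonneg hc (mul_nonneg h4 h5))
  ring

/-- Conditional expectation is an orthogonal projection in `L²`, so this expression is continuous in
`f`. -/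
theorem setIntegral_condExp_sq_eq {n : MeasurableSpace Ω} (hn : n ≤ mΩ) (A : Set Ω)
    (f : Lp ℝ 2 P) : ∫ ω in A, (P[f | n]) ω ^ 2 ∂P =
      ‖LpToLpRestrictCLM Ω ℝ ℝ P 2 A (condExpL2 ℝ ℝ hn f : Lp ℝ 2 P)‖ ^ 2 := by
  rw [norm_sq_restrict_eq]
  refine integral_congr_ae (ae_restrict_of_ae ?_)
  have h := MemLp.condExpL2_ae_eq_condExp (𝕜 := ℝ) hn (Lp.memLp f)
  rw [Lp.toLp_coeFn] at h
  filter_upwards [h] with ω hω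
  rw [hω]

/-- The nonnegative densities with a given bound on the conditional second moment of the relative
density between two σ-algebras. -/
def relDensities (P : Measure Ω) (m n : MeasurableSpace Ω) (c : ℝ) : Set (Lp ℝ 2 P) :=
  {f | 0 ≤ f ∧ ∀ A, MeasurableSet[m] A →
    ∫ ω in A, (P[f | n]) ω ^ 2 ∂P ≤ c * ∫ ω in A, (P[f | m]) ω ^ 2 ∂P}

variable {m n : MeasurableSpace Ω} {c : ℝ}

theorem isClosed_relDensities (hm : m ≤ mΩ) (hn : n ≤ mΩ) : IsClosed (relDensities P m n c) := by
  have h : IsClosed {f : Lp ℝ 2 P | ∀ A, MeasurableSet[m] A →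
      ∫ ω in A, (P[f | n]) ω ^ 2 ∂P ≤ c * ∫ ω in A, (P[f | m]) ω ^ 2 ∂P} := by
    simp only [Set.ofPred_forall]
    refine isClosed_iInter fun A => isClosed_iInter fun hA => ?_
    simp only [setIntegral_condExp_sq_eq hm, setIntegral_condExp_sq_eq hn]
    exact isClosed_le (by fun_prop) (by fun_prop)
  exact isClosed_Ici.inter h

/-- The constraint bounds a conditional norm of `P[f | n]` by `√c` times `P[f | m]`, which is linear
in `f` when `f ≥ 0`. Convexity is the conditional triangle inequality, seen here by expanding the
squares. -/
theorem convex_relDensities (hm : m ≤ mΩ) (hc : 0 ≤ c) : Convex ℝ (relDensities P m n c) := by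
  rintro f ⟨hf0, hf⟩ g ⟨hg0, hg⟩ a b ha hb hab
  refine ⟨convex_Lp_nonneg hf0 hg0 ha hb hab, fun A hA => ?_⟩
  have hlin : ∀ k : MeasurableSpace Ω, ∀ᵐ ω ∂P,
      (P[(a • f + b • g : Lp ℝ 2 P) | k]) ω = a * (P[f | k]) ω + b * (P[g | k]) ω := by
    intro k
    have h1 : P[(a • f + b • g : Lp ℝ 2 P) | k] =ᵐ[P] P[a • (f : Ω → ℝ) + b • (g : Ω → ℝ) | k] := by
      refine condExp_congr_ae ?_
      filter_upwards [Lp.coeFn_add (a • f) (b • g), Lp.coeFn_smul a f, Lp.coeFn_smul b g]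
        with ω h1 h2 h3
      rw [h1, Pi.add_apply, h2, h3]; rfl
    filter_upwards [h1, condExp_add (((Lp.memLp f).integrable one_le_two).smul a)
      (((Lp.memLp g).integrable one_le_two).smul b) k, condExp_smul (μ := P) a f k,
      condExp_smul (μ := P) b g k] with ω h1 h2 h3 h4
    rw [h1, h2, Pi.add_apply, h3, h4]; rfl
  have hf2 : ∀ k : MeasurableSpace Ω, MemLp (P[f | k]) 2 P := fun k =>
    (Lp.memLp f).condExp one_le_two
  have hg2 : ∀ k : MeasurableSpace Ω, MemLp (P[g | k]) 2 P := fun k =>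
    (Lp.memLp g).condExp one_le_two
  have hexp : ∀ k : MeasurableSpace Ω, ∫ ω in A, (P[(a • f + b • g : Lp ℝ 2 P) | k]) ω ^ 2 ∂P =
      a ^ 2 * ∫ ω in A, (P[f | k]) ω ^ 2 ∂P +
      2 * a * b * ∫ ω in A, (P[f | k]) ω * (P[g | k]) ω ∂P +
      b ^ 2 * ∫ ω in A, (P[g | k]) ω ^ 2 ∂P := by
    intro k
    have hi1 : IntegrableOn (fun ω => a ^ 2 * (P[f | k]) ω ^ 2) A P :=
      ((hf2 k).integrable_sq.const_mul _).integrableOn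
    have hi2 : IntegrableOn (fun ω => 2 * a * b * ((P[f | k]) ω * (P[g | k]) ω)) A P :=
      (((hf2 k).integrable_mul (hg2 k)).const_mul _).integrableOn
    have hi3 : IntegrableOn (fun ω => b ^ 2 * (P[g | k]) ω ^ 2) A P :=
      ((hg2 k).integrable_sq.const_mul _).integrableOn
    have hi12 : IntegrableOn (fun ω => a ^ 2 * (P[f | k]) ω ^ 2 +
      2 * a * b * ((P[f | k]) ω * (P[g | k]) ω)) A P := hi1.add hi2
    rw [← integral_const_mul, ← integral_const_mul, ← integral_const_mul,
      ← integral_add hi1 hi2, ← integral_add hi12 hi3]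
    refine integral_congr_ae (ae_restrict_of_ae ?_)
    filter_upwards [hlin k] with ω hω
    rw [hω]
    ring
  have hcross := setIntegral_mul_le_of_forall_setIntegral_sq_le hm hc (hf2 n) (hg2 n) (hf2 m)
    (hg2 m) stronglyMeasurable_condExp stronglyMeasurable_condExp
    (condExp_nonneg ((Lp.coeFn_nonneg f).2 hf0)) (condExp_nonneg ((Lp.coeFn_nonneg g).2 hg0))
    hf hg hA
  rw [hexp, hexp, mul_add, mul_add]
  refine add_le_add (add_le_add ?_ ?_) ?_
  · rw [mul_left_comm]
    exact mul_le_mul_of_nonneg_left (hf A hA) (sq_nonneg a)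
  · rw [mul_left_comm]
    exact mul_le_mul_of_nonneg_left hcross (by positivity)
  · rw [mul_left_comm]
    exact mul_le_mul_of_nonneg_left (hg A hA) (sq_nonneg b)

theorem setIntegral_mul_eq_inner {A : Set Ω} (hA : MeasurableSet[mΩ] A) (f : Lp ℝ 2 P)
    (X : Lp ℝ ∞ P) : ∫ ω in A, f ω * X ω ∂P =
      inner ℝ (((memLp_two_of_Linf X).indicator hA).toLp (A.indicator X) : Lp ℝ 2 P) f := by
  rw [inner_toLp_eq_integral, ← integral_indicator hA]
  congr 1 with ω
  by_cases hω : ω ∈ A <;> simp [hω]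

/-- Multiplying an `m`-measurable random variable by a conditional density given `m`. -/
theorem condExp_mul_of_mem_condDensities (hm : m ≤ mΩ) {h : Ω → ℝ}
    (hh : AEStronglyMeasurable[m] h P) (hL : MemLp h 2 P) {g : Lp ℝ 2 P}
    (hg : g ∈ condDensities P m n c) (hc : 0 ≤ c) :
    MemLp (fun ω => h ω * g ω) 2 P ∧ P[fun ω => h ω * g ω | m] =ᵐ[P] h ∧
      ∀ A, MeasurableSet[m] A → ∫ ω in A, (h ω * g ω) ^ 2 ∂P ≤ c * ∫ ω in A, h ω ^ 2 ∂P := by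
  -- The constant `√c` is the comparison variable: its conditional second moment is `c`.
  obtain ⟨h1, h2⟩ := memLp_mul_and_setIntegral_sq_le hm (Lp.memLp g) (z := fun _ => √c)
    (memLp_const _) hh (hL.mul_const _) (fun A hA => by
      rw [setIntegral_const, smul_eq_mul, Real.sq_sqrt hc, mul_comm]
      exact hg.2.2.2 A hA)
  refine ⟨h1, ?_, fun A hA => (h2 A hA).trans_eq ?_⟩
  · have h3 := condExp_mul_of_aestronglyMeasurable_left hh (h1.integrable one_le_two)
      ((Lp.memLp g).integrable one_le_two)
    filter_upwards [h3, condExp_eq_one_of_mem_condDensities hm hg] with ω h4 h5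
    refine h4.trans ?_
    rw [Pi.mul_apply, h5, mul_one]
  · simp only [mul_pow, Real.sq_sqrt hc]
    rw [integral_mul_const, mul_comm]

end Dynamic

/-! ### Densities compatible with prices, along finitely many dates and then along all. -/

section Compatible

open NoGoodDeal

variable {Ω : Type*} {mΩ : MeasurableSpace Ω} {P : Measure Ω} [IsProbabilityMeasure P]
  {T : ℝ} {F : Filtration (Set.Icc (0 : ℝ) T) mΩ}
  {δ : Set.Icc (0 : ℝ) T → Set.Icc (0 : ℝ) T → ℝ}
  {L : Set.Icc (0 : ℝ) T → Submodule ℝ (Lp ℝ ∞ P)} {x : ∀ s t : Set.Icc (0 : ℝ) T, L t → L s}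

/-- The densities that satisfy the no-good-deal bound between `s` and `t` and whose conditional
values at time `s` of the marketed claims payable at time `t` are the given prices. -/
def compatibleDensities (F : Filtration (Set.Icc (0 : ℝ) T) mΩ)
    (δ : Set.Icc (0 : ℝ) T → Set.Icc (0 : ℝ) T → ℝ)
    (x : ∀ s t : Set.Icc (0 : ℝ) T, L t → L s) (s t : Set.Icc (0 : ℝ) T) : Set (Lp ℝ 2 P) :=
  {f | f ∈ relDensities P (F s) (F t) (1 + δ s t ^ 2) ∧ ∀ X : L t, ∀ A, MeasurableSet[F s] A →
    ∫ ω in A, f ω * (X : Lp ℝ ∞ P) ω ∂P = ∫ ω in A, f ω * (x s t X : Lp ℝ ∞ P) ω ∂P}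

theorem isClosed_compatibleDensities (s t : Set.Icc (0 : ℝ) T) :
    IsClosed (compatibleDensities F δ x s t) := by
  refine (isClosed_relDensities (F.le s) (F.le t)).inter ?_
  have h : IsClosed {f : Lp ℝ 2 P | ∀ X : L t, ∀ A, MeasurableSet[F s] A →
      ∫ ω in A, f ω * (X : Lp ℝ ∞ P) ω ∂P = ∫ ω in A, f ω * (x s t X : Lp ℝ ∞ P) ω ∂P} := by
    simp only [Set.ofPred_forall]
    refine isClosed_iInter fun X => isClosed_iInter fun A => isClosed_iInter fun hA => ?_
    simp only [setIntegral_mul_eq_inner (F.le s A hA)]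
    exact isClosed_eq (by fun_prop) (by fun_prop)
  exact h

theorem convex_compatibleDensities (s t : Set.Icc (0 : ℝ) T) :
    Convex ℝ (compatibleDensities F δ x s t) := by
  rintro f ⟨hf1, hf2⟩ g ⟨hg1, hg2⟩ a b ha hb hab
  refine ⟨convex_relDensities (F.le s) (by positivity) hf1 hg1 ha hb hab, fun X A hA => ?_⟩
  have h1 := hf2 X A hA
  have h2 := hg2 X A hA
  rw [setIntegral_mul_eq_inner (F.le s A hA), setIntegral_mul_eq_inner (F.le s A hA)] at *
  rw [inner_add_right, inner_add_right, inner_smul_right, inner_smul_right, inner_smul_right,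
    inner_smul_right, h1, h2]

/-- A claim payable at `a` is `F a`-measurable and comes out of the conditional expectation, which
leaves the conditional mean one. So `x a a` is the identity. -/
theorem coe_price_self_eq (hL : ∀ t, L t ≤ Linf P F t) {a : Set.Icc (0 : ℝ) T} {g : Lp ℝ 2 P}
    {c : ℝ} (hg : g ∈ condDensities P (F a) (F a) c) (X : L a)
    (hgx : P[fun ω => g ω * (X : Lp ℝ ∞ P) ω | F a] =ᵐ[P] (x a a X : Lp ℝ ∞ P)) :
    (x a a X : Lp ℝ ∞ P) =ᵐ[P] (X : Lp ℝ ∞ P) := by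
  have h := condExp_mul_of_aestronglyMeasurable_right
    (mem_lpMeas_iff_aestronglyMeasurable.1 (hL a X.2)) (integrable_mul_Linf (Lp.memLp g) X)
    ((Lp.memLp g).integrable one_le_two)
  filter_upwards [h, hgx, condExp_eq_one_of_mem_condDensities (F.le a) hg] with ω h1 h2 h3
  rw [← h2]
  refine h1.trans ?_
  rw [Pi.mul_apply, h3, one_mul]

theorem mem_compatibleDensities_self (hL : ∀ t, L t ≤ Linf P F t) {a : Set.Icc (0 : ℝ) T}
    (hone : ∃ g ∈ condDensities P (F a) (F a) (1 + δ a a ^ 2), ∀ X : L a,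
      P[fun ω => g ω * (X : Lp ℝ ∞ P) ω | F a] =ᵐ[P] (x a a X : Lp ℝ ∞ P))
    {f : Lp ℝ 2 P} (hf : 0 ≤ f) : f ∈ compatibleDensities F δ x a a := by
  obtain ⟨g, hg, hgx⟩ := hone
  refine ⟨⟨hf, fun A _ => ?_⟩, fun X A _ => integral_congr_ae (ae_restrict_of_ae ?_)⟩
  · exact le_mul_of_one_le_left (integral_nonneg fun ω => sq_nonneg _)
      (by nlinarith [sq_nonneg (δ a a)])
  · filter_upwards [coe_price_self_eq hL hg X (hgx X)] with ω h
    rw [h]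

/-- With `p = δ r s` and `q = δ s t`, the composition law makes the right side `1 + (p q + p + q) ^
2`, which exceeds the left side by nonnegative cross terms. -/
theorem one_add_sq_mul_le (hδ : IsSharpeBound δ) {r s t : Set.Icc (0 : ℝ) T} (hrs : r ≤ s)
    (hst : s ≤ t) : (1 + δ s t ^ 2) * (1 + δ r s ^ 2) ≤ 1 + δ r t ^ 2 := by
  have h1 := hδ.nonneg r s hrs
  have h2 := hδ.nonneg s t hst
  rw [← hδ.comp r s t hrs hst]
  have h3 := mul_nonneg h1 h2
  nlinarith [mul_nonneg h3 h1, mul_nonneg h3 h2]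

/-- Extending a density by one period. -/
theorem exists_extend_compatible (hδ : IsSharpeBound δ) (hL : ∀ t, L t ≤ Linf P F t)
    (htc : IsTimeConsistent x) {b a : Set.Icc (0 : ℝ) T} (hba : b ≤ a)
    (hone : ∃ g ∈ condDensities P (F b) (F a) (1 + δ b a ^ 2), ∀ X : L a,
      P[fun ω => g ω * (X : Lp ℝ ∞ P) ω | F b] =ᵐ[P] (x b a X : Lp ℝ ∞ P))
    {f : Lp ℝ 2 P} (hf0 : 0 ≤ f) (hfm : AEStronglyMeasurable[F b] f P) :
    ∃ k : Lp ℝ 2 P, 0 ≤ k ∧ AEStronglyMeasurable[F a] k P ∧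
      (∀ A, MeasurableSet[F b] A → ∫ ω in A, k ω ∂P = ∫ ω in A, f ω ∂P) ∧
      ∀ s, s ≤ b → (∀ t, t ≤ b → f ∈ compatibleDensities F δ x s t →
        k ∈ compatibleDensities F δ x s t) ∧
        (f ∈ compatibleDensities F δ x s b → k ∈ compatibleDensities F δ x s a) := by
  obtain ⟨g, hg, hgx⟩ := hone
  obtain ⟨hkL, hkE, hk2⟩ := condExp_mul_of_mem_condDensities (F.le b) hfm (Lp.memLp f) hg
    (by positivity)
  -- The extension is the product `f * g`. Since `g` has conditional mean one given `F b`, nothing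
  -- changes up to time `b`.
  obtain ⟨k, hk⟩ : ∃ k : Lp ℝ 2 P, k =ᵐ[P] fun ω => f ω * g ω := ⟨hkL.toLp _, hkL.coeFn_toLp⟩
  have hki : Integrable k P := (Lp.memLp k).integrable one_le_two
  have hfi : Integrable f P := (Lp.memLp f).integrable one_le_two
  have hkb : P[k | F b] =ᵐ[P] f := (condExp_congr_ae hk).trans hkE
  have hk0 : 0 ≤ k := by
    rw [← Lp.coeFn_nonneg] at *
    filter_upwards [hk, hf0, (Lp.coeFn_nonneg g).2 hg.1] with ω h1 h2 h3
    rw [h1]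
    exact mul_nonneg h2 h3
  have hfa : AEStronglyMeasurable[F a] f P := hfm.mono (F.mono hba)
  have hkm : AEStronglyMeasurable[F a] k P := (hfa.mul hg.2.1).congr hk.symm
  have hcond : ∀ t, t ≤ b → P[k | F t] =ᵐ[P] P[f | F t] := fun t ht =>
    (condExp_condExp_of_le (F.mono ht) (F.le b)).symm.trans (condExp_congr_ae hkb)
  have hfb : P[f | F b] =ᵐ[P] f := condExp_of_aestronglyMeasurable' (F.le b) hfm hfi
  have hka : P[k | F a] =ᵐ[P] k := condExp_of_aestronglyMeasurable' (F.le a) hkm hki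
  have hset : ∀ A, MeasurableSet[F b] A → ∫ ω in A, k ω ∂P = ∫ ω in A, f ω ∂P := fun A hA =>
    setIntegral_eq_of_condExp_eq (F.le b) hki hfi (hcond b le_rfl) hA
  -- claims payable by time `b` have the same value under `f` and `k`
  have hval : ∀ Y : Lp ℝ ∞ P, Y ∈ Linf P F b → ∀ A, MeasurableSet[F b] A →
      ∫ ω in A, k ω * Y ω ∂P = ∫ ω in A, f ω * Y ω ∂P := by
    intro Y hY A hA
    have hYm := mem_lpMeas_iff_aestronglyMeasurable.1 hY
    have h1 := condExp_mul_of_aestronglyMeasurable_right hYm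
      (integrable_mul_Linf (Lp.memLp k) Y) hki
    have h2 := condExp_mul_of_aestronglyMeasurable_right hYm
      (integrable_mul_Linf (Lp.memLp f) Y) hfi
    refine setIntegral_eq_of_condExp_eq (F.le b) (integrable_mul_Linf (Lp.memLp k) Y)
      (integrable_mul_Linf (Lp.memLp f) Y) ?_ hA
    refine h1.trans (EventuallyEq.trans ?_ h2.symm)
    filter_upwards [hcond b le_rfl] with ω h
    rw [Pi.mul_apply, Pi.mul_apply, h]
  have hLb : ∀ t, t ≤ b → L t ≤ Linf P F b := fun t ht Y hY =>
    mem_lpMeas_iff_aestronglyMeasurable.2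
      ((mem_lpMeas_iff_aestronglyMeasurable.1 (hL t hY)).mono (F.mono ht))
  have hsq : ∀ {u v : Ω → ℝ} (A : Set Ω), u =ᵐ[P] v →
      ∫ ω in A, u ω ^ 2 ∂P = ∫ ω in A, v ω ^ 2 ∂P := fun A h =>
    integral_congr_ae (ae_restrict_of_ae (h.mono fun ω h => by simp only [h]))
  refine ⟨k, hk0, hkm, hset, fun s hs => ⟨fun t ht hft => ?_, fun hfs => ?_⟩⟩
  · refine ⟨⟨hk0, fun A hA => ?_⟩, fun X A hA => ?_⟩
    · rw [hsq A (hcond t ht), hsq A (hcond s hs)]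
      exact hft.1.2 A hA
    · rw [hval _ (hLb t ht X.2) A (F.mono hs A hA), hft.2 X A hA,
        hval _ (hLb s hs (x s t X).2) A (F.mono hs A hA)]
  · refine ⟨⟨hk0, fun A hA => ?_⟩, fun X A hA => ?_⟩
    · have hA' : MeasurableSet[F b] A := F.mono hs A hA
      have h1 := hfs.1.2 A hA
      rw [hsq A hfb] at h1
      rw [hsq A hka, hsq A hk, hsq A (hcond s hs)]
      -- The factor `1 + δ b a ^ 2` comes from `g` and `1 + δ s b ^ 2` from `f`; their product is at
      -- most `1 + δ s a ^ 2`.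
      refine (hk2 A hA').trans ((mul_le_mul_of_nonneg_left h1 (by positivity)).trans ?_)
      rw [← mul_assoc]
      exact mul_le_mul_of_nonneg_right (one_add_sq_mul_le hδ hs hba)
        (integral_nonneg fun ω => sq_nonneg _)
    · have hA' : MeasurableSet[F b] A := F.mono hs A hA
      have h1 : ∫ ω in A, k ω * (X : Lp ℝ ∞ P) ω ∂P =
          ∫ ω in A, f ω * (x b a X : Lp ℝ ∞ P) ω ∂P := by
        refine setIntegral_eq_of_condExp_eq (F.le b) (integrable_mul_Linf (Lp.memLp k) _)
          (integrable_mul_Linf (Lp.memLp f) _) ?_ hA'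
        have heq : (fun ω => k ω * (X : Lp ℝ ∞ P) ω) =ᵐ[P]
            (f : Ω → ℝ) * fun ω => g ω * (X : Lp ℝ ∞ P) ω := by
          filter_upwards [hk] with ω h
          rw [h, Pi.mul_apply, mul_assoc]
        have h2 := condExp_mul_of_aestronglyMeasurable_left hfm
          ((integrable_mul_Linf (Lp.memLp k) X).congr heq) (integrable_mul_Linf (Lp.memLp g) X)
        have h3 := condExp_mul_of_aestronglyMeasurable_left hfm
          (integrable_mul_Linf (Lp.memLp f) (x b a X)) ((memLp_two_of_Linf
            (x b a X : Lp ℝ ∞ P)).integrable one_le_two)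
        have h4 := condExp_of_aestronglyMeasurable' (F.le b)
          (mem_lpMeas_iff_aestronglyMeasurable.1 (hL b (x b a X).2))
          ((memLp_two_of_Linf (x b a X : Lp ℝ ∞ P)).integrable one_le_two)
        refine (condExp_congr_ae heq).trans (h2.trans (EventuallyEq.trans ?_ h3.symm))
        filter_upwards [hgx X, h4] with ω h5 h6
        rw [Pi.mul_apply, Pi.mul_apply, h5, h6]
      -- `g` prices `X` back to `b`, `f` prices the result back to `s`, and time-consistency
      -- identifies the composite with `x s a X`.
      rw [h1, hfs.2 (x b a X) A hA, ← htc s b a hs hba X, hval _ (hLb s hs (x s a X).2) A hA']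

theorem mem_condDensities_of_mem_relDensities {m n : MeasurableSpace Ω} {c : ℝ} (hm : m ≤ mΩ)
    (hn : n ≤ mΩ) {f : Lp ℝ 2 P} (hfn : AEStronglyMeasurable[n] f P)
    (hfm : ∀ A, MeasurableSet[m] A → ∫ ω in A, f ω ∂P = P.real A)
    (hf : f ∈ relDensities P m n c) : f ∈ condDensities P m n c := by
  refine ⟨hf.1, hfn, hfm, fun A hA => ?_⟩
  have hfi : Integrable f P := (Lp.memLp f).integrable one_le_two
  have h1 : P[f | m] =ᵐ[P] fun _ => 1 := by
    have h := condExp_eq_condExp_of_forall_setIntegral_eq hm (f := f)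
      (g := fun _ => (1 : ℝ)) hfi (integrable_const 1) (fun A hA => by
        rw [hfm A hA]; simp)
    rwa [condExp_const hm] at h
  have h2 := condExp_of_aestronglyMeasurable' hn hfn hfi
  have h := hf.2 A hA
  have e1 : ∫ ω in A, (P[f | n]) ω ^ 2 ∂P = ∫ ω in A, f ω ^ 2 ∂P :=
    integral_congr_ae (ae_restrict_of_ae (h2.mono fun ω h => by simp only [h]))
  have e2 : ∫ ω in A, (P[f | m]) ω ^ 2 ∂P = ∫ ω in A, (1 : ℝ) ∂P :=
    integral_congr_ae (ae_restrict_of_ae (h1.mono fun ω h => by simp only [h, one_pow]))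
  rw [e1, e2] at h
  simpa using h

/-- Densities compatible with the prices along finitely many dates. -/
theorem exists_mem_compatibleDensities_finset (hδ : IsSharpeBound δ)
    (hL : ∀ t, L t ≤ Linf P F t) (htc : IsTimeConsistent x)
    (hone : ∀ s t, s ≤ t → ∃ g ∈ condDensities P (F s) (F t) (1 + δ s t ^ 2), ∀ X : L t,
      P[fun ω => g ω * (X : Lp ℝ ∞ P) ω | F s] =ᵐ[P] (x s t X : Lp ℝ ∞ P))
    {z : Set.Icc (0 : ℝ) T} (hz : ∀ t, z ≤ t) (S : Finset (Set.Icc (0 : ℝ) T)) :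
    ∃ f : Lp ℝ 2 P, 0 ≤ f ∧ (∀ t, (∀ u ∈ S, u ≤ t) → AEStronglyMeasurable[F t] f P) ∧
      (∀ A, MeasurableSet[F z] A → ∫ ω in A, f ω ∂P = P.real A) ∧
      ∀ s ∈ S, ∀ t ∈ S, s ≤ t → f ∈ compatibleDensities F δ x s t := by
  classical
  -- Dates are added in increasing order, so the density of the earlier stage is measurable at the
  -- last earlier date `b`, and only pairs ending at the new date are new.
  induction S using Finset.induction_on_max with
  | empty =>
    have h1 : ∀ t, Lp.const 2 P (1 : ℝ) ∈ condDensities P (F z) (F t) 1 := fun t =>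
      one_mem_condDensities le_rfl
    exact ⟨_, (h1 z).1, fun t _ => (h1 t).2.1, (h1 z).2.2.1, by simp⟩
  | insert a S ha ih =>
    obtain ⟨f, hf0, hfm, hfz, hfS⟩ := ih
    rcases S.eq_empty_or_nonempty with rfl | hS
    · refine ⟨f, hf0, fun t _ => hfm t (by simp), hfz, fun s hs t ht _ => ?_⟩
      simp only [insert_empty_eq, Finset.mem_singleton] at hs ht
      subst hs ht
      exact mem_compatibleDensities_self hL (hone _ _ le_rfl) hf0
    · have hbS := S.max'_mem hS
      set b := S.max' hS
      have hmax : ∀ u ∈ S, u ≤ b := fun u hu => S.le_max' u hu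
      obtain ⟨k, hk0, hkm, hkb, hk⟩ := exists_extend_compatible hδ hL htc (ha b hbS).le
        (hone b a (ha b hbS).le) hf0 (hfm b hmax)
      refine ⟨k, hk0, fun t ht => hkm.mono (F.mono (ht a (Finset.mem_insert_self a S))),
        fun A hA => (hkb A (F.mono (hz b) A hA)).trans (hfz A hA), fun s hs t ht hst => ?_⟩
      rcases Finset.mem_insert.1 hs with rfl | hs' <;> rcases Finset.mem_insert.1 ht with rfl | ht'
      · exact mem_compatibleDensities_self hL (hone _ _ le_rfl) hk0
      · exact absurd (ha t ht') hst.not_gt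
      · exact (hk s (hmax s hs')).2 (hfS s hs' b hbS (hmax s hs'))
      · exact (hk s (hmax s hs')).1 t (hmax t ht') (hfS s hs' t ht' hst)

/-- A density compatible with all prices. -/
theorem exists_forall_mem_compatibleDensities (hδ : IsSharpeBound δ)
    (hL : ∀ t, L t ≤ Linf P F t) (htc : IsTimeConsistent x)
    (hone : ∀ s t, s ≤ t → ∃ g ∈ condDensities P (F s) (F t) (1 + δ s t ^ 2), ∀ X : L t,
      P[fun ω => g ω * (X : Lp ℝ ∞ P) ω | F s] =ᵐ[P] (x s t X : Lp ℝ ∞ P))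
    {z e : Set.Icc (0 : ℝ) T} (hz : ∀ t, z ≤ t) (hFe : F e = mΩ) :
    ∃ f : Lp ℝ 2 P, 0 ≤ f ∧ (∀ A, MeasurableSet[F z] A → ∫ ω in A, f ω ∂P = P.real A) ∧
      ∀ s t, s ≤ t → f ∈ compatibleDensities F δ x s t := by
  classical
  let B : Set (Lp ℝ 2 P) :=
    {f | 0 ≤ f} ∩ {f | ∀ A, MeasurableSet[F z] A → ∫ ω in A, f ω ∂P = P.real A}
  -- The end dates `z` and `e` are always included: their constraint gives the uniform bound `√(1 +
  -- δ z e ^ 2)` on the norms.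
  let K : Finset (Set.Icc (0 : ℝ) T) → Set (Lp ℝ 2 P) := fun S =>
    B ∩ ⋂ s ∈ insert z (insert e S), ⋂ t ∈ insert z (insert e S), ⋂ _ : s ≤ t,
      compatibleDensities F δ x s t
  have hBcl : IsClosed B := by
    have h : IsClosed {f : Lp ℝ 2 P | ∀ A, MeasurableSet[F z] A → ∫ ω in A, f ω ∂P = P.real A} := by
      simp only [Set.ofPred_forall]
      refine isClosed_iInter fun A => isClosed_iInter fun hA => ?_
      simp only [setIntegral_eq_inner (F.le z A hA)]
      exact isClosed_eq (by fun_prop) continuous_const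
    exact isClosed_Ici.inter h
  have hBcv : Convex ℝ B := by
    refine convex_Lp_nonneg.inter ?_
    intro f hf g hg a b ha hb hab A hA
    have h1 := hf A hA
    have h2 := hg A hA
    rw [setIntegral_eq_inner (F.le z A hA)] at *
    rw [inner_add_right, inner_smul_right, inner_smul_right, h1, h2, ← add_mul, hab, one_mul]
  obtain ⟨f, hf⟩ := nonempty_iInter_of_directed_of_convex K
    (fun S S' => by
      have hmono : ∀ S S', S ⊆ S' → K S' ⊆ K S := fun S S' h =>
        Set.inter_subset_inter_right _ <| by
          have h' := Finset.insert_subset_insert z (Finset.insert_subset_insert e h)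
          exact Set.iInter₂_mono' fun s hs => ⟨s, h' hs, Set.iInter₂_mono' fun t ht =>
            ⟨t, h' ht, subset_rfl⟩⟩
      exact ⟨S ∪ S', hmono _ _ Finset.subset_union_left, hmono _ _ Finset.subset_union_right⟩)
    (fun S => by
      obtain ⟨f, hf0, -, hfz, hf⟩ := exists_mem_compatibleDensities_finset hδ hL htc hone hz
        (insert z (insert e S))
      exact ⟨f, ⟨hf0, hfz⟩, by simpa only [Set.mem_iInter] using hf⟩)
    (fun S => hBcl.inter (isClosed_biInter fun s _ => isClosed_biInter fun t _ =>
      isClosed_iInter fun _ => isClosed_compatibleDensities s t))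
    (fun S => hBcv.inter (convex_iInter₂ fun s _ => convex_iInter₂ fun t _ =>
      convex_iInter fun _ => convex_compatibleDensities s t)) (√(1 + δ z e ^ 2))
    (by
      rintro S f ⟨⟨hf0, hfz⟩, hf⟩
      simp only [Set.mem_iInter] at hf
      refine norm_le_of_mem_condDensities (mem_condDensities_of_mem_relDensities (F.le z) (F.le e)
        (by rw [hFe]; exact Lp.aestronglyMeasurable f) hfz
        (hf z (by simp) e (by simp) (hz e)).1))
  have hf' : ∀ S, f ∈ K S := fun S => Set.mem_iInter.1 hf S
  refine ⟨f, (hf' ∅).1.1, (hf' ∅).1.2, fun s t hst => ?_⟩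
  have h := (hf' {s, t}).2
  simp only [Set.mem_iInter] at h
  exact h s (by simp) t (by simp) hst

end Compatible

/-! ### Conditional expectation under an equivalent measure as a price operator. -/

section Pricing

open NoGoodDeal

variable {Ω : Type*} {m n mΩ : MeasurableSpace Ω} {P : Measure Ω}

theorem integrable_Linf_of_ac {Q : Measure Ω} [IsFiniteMeasure Q] (hQP : Q ≪ P)
    (X : Lp ℝ ∞ P) : Integrable X Q :=
  Integrable.of_bound ((Lp.aestronglyMeasurable X).mono_ac hQP) ‖X‖
    (hQP.ae_le (abs_coeFn_le_norm_Linf X))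

theorem memLp_condExp_Linf {Q : Measure Ω} (hm : m ≤ mΩ) (hPQ : P ≪ Q) (hQP : Q ≪ P) (X : Lp ℝ ∞ P) :
    MemLp (Q[X | m]) ∞ P := by
  refine memLp_top_of_bound (stronglyMeasurable_condExp.mono hm).aestronglyMeasurable ‖X‖
    (hPQ.ae_le ?_)
  exact ae_bdd_abs_condExp_of_ae_bdd_abs (R := ‖X‖) (hQP.ae_le (abs_coeFn_le_norm_Linf X))

/-- The conditional expectation under an equivalent measure `Q` as a linear operator on `L_∞`. -/
noncomputable def condExpLinf {Q : Measure Ω} [IsFiniteMeasure Q] (hm : m ≤ mΩ) (hPQ : P ≪ Q) (hQP : Q ≪ P) :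
    Lp ℝ ∞ P →ₗ[ℝ] lpMeas ℝ ℝ m ∞ P where
  toFun X := ⟨(memLp_condExp_Linf hm hPQ hQP X).toLp _, by
    rw [mem_lpMeas_iff_aestronglyMeasurable]
    exact stronglyMeasurable_condExp.aestronglyMeasurable.congr (MemLp.coeFn_toLp _).symm⟩
  map_add' X Y := by
    refine Subtype.ext ?_
    change (memLp_condExp_Linf hm hPQ hQP _).toLp _ = (memLp_condExp_Linf hm hPQ hQP _).toLp _ +
      (memLp_condExp_Linf hm hPQ hQP _).toLp _
    rw [← MemLp.toLp_add, MemLp.toLp_eq_toLp_iff]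
    exact hPQ.ae_le ((condExp_congr_ae (hQP.ae_le (Lp.coeFn_add X Y))).trans
      (condExp_add (integrable_Linf_of_ac hQP X) (integrable_Linf_of_ac hQP Y) m))
  map_smul' r X := by
    refine Subtype.ext ?_
    change (memLp_condExp_Linf hm hPQ hQP _).toLp _ =
      r • (memLp_condExp_Linf hm hPQ hQP _).toLp _
    rw [← MemLp.toLp_const_smul, MemLp.toLp_eq_toLp_iff]
    exact hPQ.ae_le ((condExp_congr_ae (hQP.ae_le (Lp.coeFn_smul r X))).trans
      (condExp_smul r _ m))

theorem coeFn_condExpLinf {Q : Measure Ω} [IsFiniteMeasure Q] (hm : m ≤ mΩ) (hPQ : P ≪ Q) (hQP : Q ≪ P) (X : Lp ℝ ∞ P) :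
    (condExpLinf hm hPQ hQP X : Lp ℝ ∞ P) =ᵐ[P] Q[X | m] :=
  MemLp.coeFn_toLp (memLp_condExp_Linf hm hPQ hQP X)

variable [IsProbabilityMeasure P]

theorem condExp_pos_of_pos (hm : m ≤ mΩ) {f : Ω → ℝ} (hf : Integrable f P)
    (hpos : ∀ᵐ ω ∂P, 0 < f ω) : ∀ᵐ ω ∂P, 0 < (P[f | m]) ω := by
  have hA : MeasurableSet[m] {ω | (P[f | m]) ω ≤ 0} :=
    (stronglyMeasurable_condExp (μ := P) (f := f)).measurable measurableSet_Iic
  have h1 : ∫ ω in {ω | (P[f | m]) ω ≤ 0}, f ω ∂P ≤ 0 := by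
    rw [← setIntegral_condExp hm hf hA]
    exact setIntegral_nonpos (hm _ hA) fun ω hω => hω
  have h2 : f =ᵐ[P.restrict {ω | (P[f | m]) ω ≤ 0}] 0 :=
    (integral_eq_zero_iff_of_nonneg_ae (ae_restrict_of_ae (hpos.mono fun ω h => h.le))
      hf.integrableOn).1 (le_antisymm h1 (integral_nonneg_of_ae
        (ae_restrict_of_ae (hpos.mono fun ω h => h.le))))
  filter_upwards [hpos, (ae_restrict_iff' (hm _ hA)).1 h2] with ω h3 h4
  by_contra h5
  exact h3.ne' (h4 (not_lt.1 h5))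

/-- The relative density between two σ-algebras of an equivalent measure. -/
theorem exists_mem_condDensities_div (hm : m ≤ mΩ) (hn : n ≤ mΩ) (hmn : m ≤ n) {c : ℝ}
    (hc : 0 ≤ c) {f : Lp ℝ 2 P} (hf : f ∈ relDensities P m n c) (hpos : ∀ᵐ ω ∂P, 0 < f ω) :
    ∃ q ∈ condDensities P m n c, (q =ᵐ[P] fun ω => (P[f | n]) ω * ((P[f | m]) ω)⁻¹) ∧
      ∀ X : Lp ℝ ∞ P, AEStronglyMeasurable[n] X P → P[fun ω => q ω * X ω | m] =ᵐ[P]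
        (P.withDensity fun ω => ENNReal.ofReal (f ω))[X | m] := by
  have hfi : Integrable f P := (Lp.memLp f).integrable one_le_two
  have hm0 := condExp_pos_of_pos hm hfi hpos
  have hn0 := condExp_pos_of_pos hn hfi hpos
  have hmL : MemLp (P[f | m]) 2 P := (Lp.memLp f).condExp one_le_two
  have hnL : MemLp (P[f | n]) 2 P := (Lp.memLp f).condExp one_le_two
  have hinv : StronglyMeasurable[m] fun ω => ((P[f | m]) ω)⁻¹ :=
    stronglyMeasurable_condExp.measurable.inv.stronglyMeasurable
  -- Dividing the comparison variable `√c * P[f | m]` by `P[f | m]` leaves a constant; this yields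
  -- both square-integrability of the quotient and its conditional bound.
  have hone : (fun ω => ((P[f | m]) ω)⁻¹ * (√c * (P[f | m]) ω)) =ᵐ[P] fun _ => √c := by
    filter_upwards [hm0] with ω h
    field_simp
  obtain ⟨hL, hsq⟩ := memLp_mul_and_setIntegral_sq_le hm hnL (hmL.const_mul √c)
    hinv.aestronglyMeasurable ((memLp_congr_ae hone).2 (memLp_const _)) (fun A hA => by
      simp only [mul_pow, Real.sq_sqrt hc]
      rw [integral_const_mul]
      exact hf.2 A hA)
  obtain ⟨q, hq⟩ : ∃ q : Lp ℝ 2 P, q =ᵐ[P] fun ω => ((P[f | m]) ω)⁻¹ * (P[f | n]) ω :=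
    ⟨hL.toLp _, hL.coeFn_toLp⟩
  have hqn : AEStronglyMeasurable[n] q P := by
    have h : StronglyMeasurable[n] fun ω => ((P[f | m]) ω)⁻¹ * (P[f | n]) ω :=
      (hinv.mono hmn).mul stronglyMeasurable_condExp
    exact h.aestronglyMeasurable.congr hq.symm
  have hval : ∀ X : Lp ℝ ∞ P, AEStronglyMeasurable[n] X P → P[fun ω => q ω * X ω | m] =ᵐ[P]
        (P.withDensity fun ω => ENNReal.ofReal (f ω))[X | m] := by
    intro X hX
    have hnX : Integrable (fun ω => (P[f | n]) ω * X ω) P := integrable_mul_Linf hnL X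
    have heq : (fun ω => q ω * X ω) =ᵐ[P]
        (fun ω => ((P[f | m]) ω)⁻¹) * fun ω => (P[f | n]) ω * X ω := by
      filter_upwards [hq] with ω h
      rw [h, Pi.mul_apply, mul_assoc]
    have h1 := condExp_mul_of_stronglyMeasurable_left hinv
      ((integrable_mul_Linf (Lp.memLp q) X).congr heq) hnX
    have h2 : P[fun ω => f ω * X ω | n] =ᵐ[P] fun ω => (P[f | n]) ω * X ω :=
      condExp_mul_of_aestronglyMeasurable_right hX (integrable_mul_Linf (Lp.memLp f) X) hfi
    have h3 : P[fun ω => (P[f | n]) ω * X ω | m] =ᵐ[P] P[fun ω => f ω * X ω | m] :=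
      (condExp_congr_ae h2.symm).trans (condExp_condExp_of_le hmn hn)
    have h4 := condExp_mul_eq_condExp_withDensity hm hfi ((Lp.coeFn_nonneg f).2 hf.1)
      (integrable_mul_Linf (Lp.memLp f) X)
    -- The tower property produces the numerator of Bayes' formula, and the factor `P[f | m]`
    -- cancels.
    filter_upwards [(condExp_congr_ae heq).trans h1, h3, h4, hm0] with ω h5 h6 h7 h8
    rw [h5, Pi.mul_apply, h6, h7, inv_mul_cancel_left₀ h8.ne']
  refine ⟨q, ⟨?_, hqn, fun A hA => ?_, fun A hA => ?_⟩, ?_, hval⟩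
  · rw [← Lp.coeFn_nonneg]
    filter_upwards [hq, hm0, hn0] with ω h1 h2 h3
    rw [h1]
    exact mul_nonneg (inv_nonneg.2 h2.le) h3.le
  · have h1 := condExp_mul_of_stronglyMeasurable_left hinv (hL.integrable one_le_two)
      integrable_condExp
    have h2 := condExp_condExp_of_le (μ := P) (f := (f : Ω → ℝ)) hmn hn
    have h3 : P[q | m] =ᵐ[P] fun _ => 1 := by
      filter_upwards [(condExp_congr_ae hq).trans h1, h2, hm0] with ω h4 h5 h6
      rw [h4, Pi.mul_apply, h5, inv_mul_cancel₀ h6.ne']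
    rw [← setIntegral_condExp hm ((Lp.memLp q).integrable one_le_two) hA,
      integral_congr_ae (ae_restrict_of_ae h3)]
    simp
  · have e1 : ∫ ω in A, q ω ^ 2 ∂P = ∫ ω in A, (((P[f | m]) ω)⁻¹ * (P[f | n]) ω) ^ 2 ∂P :=
      integral_congr_ae (ae_restrict_of_ae (hq.mono fun ω h => by simp only [h]))
    have e2 : ∫ ω in A, (((P[f | m]) ω)⁻¹ * (√c * (P[f | m]) ω)) ^ 2 ∂P =
        ∫ ω in A, √c ^ 2 ∂P :=
      integral_congr_ae (ae_restrict_of_ae (hone.mono fun ω h => by simp only [h]))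
    have h := hsq A hA
    rw [← e1, e2, setIntegral_const, Real.sq_sqrt hc, smul_eq_mul, mul_comm] at h
    exact h
  · filter_upwards [hq] with ω h
    rw [h, mul_comm]

variable {T : ℝ} {F : Filtration (Set.Icc (0 : ℝ) T) mΩ} {Q : Measure Ω}
  [IsProbabilityMeasure Q]

theorem isPriceOperator_condExpLinf (hPQ : P ≪ Q) (hQP : Q ≪ P) {s t : Set.Icc (0 : ℝ) T} :
    IsPriceOperator P F s (D := Linf P F t) (E := Linf P F s)
      ((condExpLinf (F.le s) hPQ hQP).domRestrict (Linf P F t)) := by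
  have hcoe : ∀ X : Linf P F t, (((condExpLinf (F.le s) hPQ hQP).domRestrict (Linf P F t) X :
      Lp ℝ ∞ P) : Ω → ℝ) =ᵐ[P] Q[(X : Lp ℝ ∞ P) | F s] := fun X =>
    coeFn_condExpLinf (F.le s) hPQ hQP X
  have hint := integrable_Linf_of_ac (P := P) hQP
  have hmono : ∀ X' X : Linf P F t, (X' : Lp ℝ ∞ P) ≤ X →
      ((condExpLinf (F.le s) hPQ hQP).domRestrict (Linf P F t) X' : Lp ℝ ∞ P) ≤
        (condExpLinf (F.le s) hPQ hQP).domRestrict (Linf P F t) X := by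
    intro X' X h
    rw [← Lp.coeFn_le] at h ⊢
    filter_upwards [hcoe X', hcoe X, hPQ.ae_le (condExp_mono (m := F s) (hint X') (hint X)
      (hQP.ae_le h))] with ω h1 h2 h3
    rwa [h1, h2]
  refine ⟨hmono, fun X' X h => ?_, fun X' X => map_add _ X' X, fun l hl _ X Y hY => ?_, ?_⟩
  -- Ordered claims with equal prices have equal `Q`-integrals, hence agree `Q`-a.s. and, by
  -- equivalence, `P`-a.s.
  · refine lt_of_le_of_ne (hmono X' X h.le) fun heq => h.ne ?_
    have h1 : Q[(X' : Lp ℝ ∞ P) | F s] =ᵐ[P] Q[(X : Lp ℝ ∞ P) | F s] := by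
      refine (hcoe X').symm.trans (EventuallyEq.trans ?_ (hcoe X))
      rw [heq]
    have h2 : ∫ ω, (X' : Lp ℝ ∞ P) ω ∂Q = ∫ ω, (X : Lp ℝ ∞ P) ω ∂Q := by
      rw [← integral_condExp (F.le s) (f := (X' : Lp ℝ ∞ P)),
        ← integral_condExp (F.le s) (f := (X : Lp ℝ ∞ P))]
      exact integral_congr_ae (hQP.ae_le h1)
    have h3 := (integral_eq_iff_of_ae_le (hint X') (hint X)
      (hQP.ae_le ((Lp.coeFn_le _ _).2 h.le))).1 h2
    exact Lp.ext (hPQ.ae_le h3)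
  · have hl' : AEStronglyMeasurable[F s] l Q := by
      obtain ⟨k, hk, hlk⟩ := mem_lpMeas_iff_aestronglyMeasurable.1 hl
      exact ⟨k, hk, hQP.ae_le hlk⟩
    have h1 := condExp_mul_of_aestronglyMeasurable_left hl'
      ((hint Y).congr (hQP.ae_le hY)) (hint X)
    have h2 : Q[(Y : Lp ℝ ∞ P) | F s] =ᵐ[Q] Q[(l : Ω → ℝ) * (X : Lp ℝ ∞ P) | F s] :=
      condExp_congr_ae (hQP.ae_le hY)
    filter_upwards [hcoe X, hcoe Y, hPQ.ae_le (h2.trans h1)] with ω h3 h4 h5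
    rw [h4, h5, Pi.mul_apply, h3]
  · refine ⟨Lp_const_mem_Linf 1, Lp.ext ?_⟩
    have hone : one P =ᵐ[P] fun _ => (1 : ℝ) := Lp.coeFn_const (p := ∞) (μ := P) (1 : ℝ)
    have h1 : Q[(one P : Ω → ℝ) | F s] =ᵐ[Q] Q[fun _ => (1 : ℝ) | F s] :=
      condExp_congr_ae (hQP.ae_le hone)
    rw [condExp_const (F.le s)] at h1
    filter_upwards [hcoe ⟨one P, Lp_const_mem_Linf 1⟩, hPQ.ae_le h1, hone] with ω h2 h3 h4
    exact h2.trans (h3.trans h4.symm)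

end Pricing

/-! ### Strict positivity of the density and the dynamic no-good-deal bound. -/

section Pricing

open NoGoodDeal

variable {Ω : Type*} {mΩ : MeasurableSpace Ω} {P : Measure Ω} [IsProbabilityMeasure P]
  {T : ℝ} {F : Filtration (Set.Icc (0 : ℝ) T) mΩ}
  {δ : Set.Icc (0 : ℝ) T → Set.Icc (0 : ℝ) T → ℝ} {s t : Set.Icc (0 : ℝ) T}

/-- The indicator of `{f = 0}` is worth zero under `f`; were it a nonzero claim, its lower bound
could not be positive. -/
theorem ae_pos_of_lowerBound_pos (hpos : ∀ X : Lp ℝ ∞ P, 0 < X → 0 < lowerBound P F δ s t X)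
    {f : Lp ℝ 2 P} (hf : f ∈ condDensities P (F s) (F t) (1 + δ s t ^ 2)) :
    ∀ᵐ ω ∂P, 0 < f ω := by
  have hA : MeasurableSet {ω | f ω = 0} := (Lp.stronglyMeasurable f).measurable
    (measurableSet_singleton 0)
  suffices h : P {ω | f ω = 0} = 0 by
    filter_upwards [(Lp.coeFn_nonneg f).2 hf.1, compl_mem_ae_iff.2 h] with ω h1 h2
    exact lt_of_le_of_ne h1 fun h3 => h2 h3.symm
  by_contra hP
  set X : Lp ℝ ∞ P := indicatorConstLp ∞ hA (measure_ne_top P _) (1 : ℝ) with hXdef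
  have hX : X =ᵐ[P] {ω | f ω = 0}.indicator fun _ => (1 : ℝ) := indicatorConstLp_coeFn
  have hX0 : 0 < X := by
    refine lt_of_le_of_ne ?_ fun h => hP ?_
    · rw [← Lp.coeFn_nonneg]
      filter_upwards [hX] with ω h
      rw [h]
      exact Set.indicator_nonneg (fun _ _ => zero_le_one) ω
    · have h1 : ∀ᵐ ω ∂P, ω ∉ {ω | f ω = 0} := by
        rw [← h] at hX
        filter_upwards [hX, Lp.coeFn_zero ℝ ∞ P] with ω h1 h2 h3
        rw [h2, Set.indicator_of_mem (show ω ∈ {ω | f ω = 0} from h3)] at h1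
        exact zero_ne_one h1
      exact measure_eq_zero_iff_ae_notMem.2 h1
  refine (hpos X hX0).not_ge (((isGLB_lowerBound X).1 ⟨f, hf, rfl⟩).trans ?_)
  rw [← AEEqFun.coeFn_le]
  have h0 : P[fun ω => f ω * X ω | F s] =ᵐ[P] P[(0 : Ω → ℝ) | F s] := by
    refine condExp_congr_ae ?_
    filter_upwards [hX] with ω h
    rw [h]
    by_cases hω : f ω = 0 <;> simp [hω]
  rw [condExp_zero] at h0
  filter_upwards [h0, AEEqFun.coeFn_mk (μ := P) (P[fun ω => f ω * X ω | F s])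
    (stronglyMeasurable_condExp.mono (F.le s)).aestronglyMeasurable,
    AEEqFun.coeFn_zero (α := Ω) (μ := P) (β := ℝ)] with ω h1 h2 h3
  rw [h2, h1, h3]

/-- The prices of the marketed claims are the conditional expectations under the measure with a
compatible density. -/
theorem price_eq_condExp_withDensity {L : Set.Icc (0 : ℝ) T → Submodule ℝ (Lp ℝ ∞ P)}
    (hL : ∀ t, L t ≤ Linf P F t) {x : ∀ s t : Set.Icc (0 : ℝ) T, L t → L s} {f : Lp ℝ 2 P}
    (hf : f ∈ compatibleDensities F δ x s t) (hpos : ∀ᵐ ω ∂P, 0 < f ω) (X : L t) :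
    (x s t X : Lp ℝ ∞ P) =ᵐ[P]
      (P.withDensity fun ω => ENNReal.ofReal (f ω))[(X : Lp ℝ ∞ P) | F s] := by
  have hfi : Integrable f P := (Lp.memLp f).integrable one_le_two
  have h1 := condExp_mul_eq_condExp_withDensity (F.le s) hfi ((Lp.coeFn_nonneg f).2 hf.1.1)
    (integrable_mul_Linf (Lp.memLp f) X)
  have h2 := condExp_eq_condExp_of_forall_setIntegral_eq (F.le s)
    (integrable_mul_Linf (Lp.memLp f) X) (integrable_mul_Linf (Lp.memLp f) (x s t X)) (hf.2 X)
  have h3 := condExp_mul_of_aestronglyMeasurable_right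
    (mem_lpMeas_iff_aestronglyMeasurable.1 (hL s (x s t X).2))
    (integrable_mul_Linf (Lp.memLp f) (x s t X)) hfi
  filter_upwards [h1, h2, h3, condExp_pos_of_pos (F.le s) hfi hpos] with ω h4 h5 h6 h7
  have h8 := h6.symm.trans (h5.symm.trans h4)
  exact mul_left_cancel₀ h7.ne' h8

/-- The quotient `D_t / D_s` is a conditional density `q`, so `E[(q - 1)² | F_s] = E[q² | F_s] - 1`,
which turns the bound `1 + δ²` back into `δ²`. -/
theorem isDynamicNoGoodDealMeasure_withDensity {f : Lp ℝ 2 P}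
    [hprob : IsProbabilityMeasure (P.withDensity fun ω => ENNReal.ofReal (f ω))]
    (hpos : ∀ᵐ ω ∂P, 0 < f ω)
    (hf : ∀ s t, s ≤ t → f ∈ relDensities P (F s) (F t) (1 + δ s t ^ 2)) :
    IsDynamicNoGoodDealMeasure P F δ (P.withDensity fun ω => ENNReal.ofReal (f ω)) := by
  have hmeas : AEMeasurable (fun ω => ENNReal.ofReal (f ω)) P :=
    (Lp.aestronglyMeasurable f).aemeasurable.ennreal_ofReal
  set Q := P.withDensity fun ω => ENNReal.ofReal (f ω) with hQ
  have hrn : (fun ω => (Q.rnDeriv P ω).toReal) =ᵐ[P] f := by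
    filter_upwards [Measure.rnDeriv_withDensity₀ P hmeas, hpos] with ω h1 h2
    rw [hQ, h1, ENNReal.toReal_ofReal h2.le]
  have hD : ∀ t, densityProcess P Q F t =ᵐ[P] P[f | F t] := fun t => condExp_congr_ae hrn
  refine ⟨hprob, withDensity_absolutelyContinuous _ _,
    withDensity_absolutelyContinuous' hmeas (hpos.mono fun ω h => by simpa using h),
    (memLp_congr_ae hrn).2 (Lp.memLp f), fun s t hst => ?_⟩
  obtain ⟨q, hq, hqD, -⟩ := exists_mem_condDensities_div (F.le s) (F.le t) (F.mono hst)
    (by positivity) (hf s t hst) hpos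
  have heq : (fun ω => (densityProcess P Q F t ω * (densityProcess P Q F s ω)⁻¹ - 1) ^ 2)
      =ᵐ[P] fun ω => (q ω - 1) ^ 2 := by
    filter_upwards [hD t, hD s, hqD] with ω h1 h2 h3
    rw [h1, h2, h3]
  have hint : Integrable (fun ω => (q ω - 1) ^ 2) P :=
    ((Lp.memLp q).sub (memLp_const 1)).integrable_sq
  refine ⟨hint.congr heq.symm, (condExp_congr_ae heq).le.trans ?_⟩
  have h := condExp_le_condExp_of_forall_setIntegral_le (P := P) (F.le s)
    (g := fun _ => δ s t ^ 2) hint (integrable_const _) (fun A hA => by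
      have h1 := hq.2.2.2 A hA
      rw [setIntegral_sub_one_sq (Lp.memLp q), hq.2.2.1 A hA, setIntegral_const, smul_eq_mul]
      linarith)
  rwa [condExp_const (F.le s)] at h

end Pricing

/-! ### The extension theorem. -/

theorem mainTheorem4 {Ω : Type*} [mΩ : MeasurableSpace Ω] (P : Measure Ω) [IsProbabilityMeasure P]
    (T : ℝ) (hT : 0 < T) (F : Filtration (Set.Icc (0 : ℝ) T) mΩ) [F.IsRightContinuous]
    (hFT : F ⟨T, hT.le, le_rfl⟩ = mΩ)
    (δ : Set.Icc (0 : ℝ) T → Set.Icc (0 : ℝ) T → ℝ) (hδ : NoGoodDeal.IsSharpeBound δ)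
    (L : Set.Icc (0 : ℝ) T → Submodule ℝ (Lp ℝ ∞ P))
    (hL : ∀ t, L t ≤ NoGoodDeal.Linf P F t)
    (x : ∀ s t : Set.Icc (0 : ℝ) T, L t → L s)
    (hprice : ∀ s t, s ≤ t → NoGoodDeal.IsPriceOperator P F s (x s t))
    (htc : NoGoodDeal.IsTimeConsistent x)
    (hrc : NoGoodDeal.IsRightContinuousFamily x)
    (hsand : ∀ s t, s ≤ t → ∀ X : L t, ∀ Y ∈ NoGoodDeal.Linf P F t, ∀ Z ∈ NoGoodDeal.Linf P F t,
      0 ≤ Y → 0 ≤ Z → Z + (X : Lp ℝ ∞ P) ≤ Y →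
      NoGoodDeal.lowerBound P F δ s t Z + ((x s t X : Lp ℝ ∞ P) : Ω →ₘ[P] ℝ)
        ≤ NoGoodDeal.upperBound P F δ s t Y)
    (hpos : ∀ X : Lp ℝ ∞ P, 0 < X →
      0 < NoGoodDeal.lowerBound P F δ ⟨0, le_rfl, hT.le⟩ ⟨T, hT.le, le_rfl⟩ X) :
    ∃ (xhat : ∀ s t : Set.Icc (0 : ℝ) T, NoGoodDeal.Linf P F t →ₗ[ℝ] NoGoodDeal.Linf P F s)
      (P₀ : Measure Ω),
      -- a time-consistent family of linear price operators extending `x`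
      (∀ s t, s ≤ t → NoGoodDeal.IsPriceOperator P F s (xhat s t)) ∧
      NoGoodDeal.IsTimeConsistent (fun s t => xhat s t) ∧
      (∀ s t, s ≤ t → ∀ X : L t,
        (xhat s t ⟨X, hL t X.2⟩ : Lp ℝ ∞ P) = (x s t X : Lp ℝ ∞ P)) ∧
      -- sandwich bounds
      (∀ s t, s ≤ t → ∀ X : NoGoodDeal.Linf P F t, 0 ≤ (X : Lp ℝ ∞ P) →
        NoGoodDeal.lowerBound P F δ s t X ≤ ((xhat s t X : Lp ℝ ∞ P) : Ω →ₘ[P] ℝ) ∧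
        ((xhat s t X : Lp ℝ ∞ P) : Ω →ₘ[P] ℝ) ≤ NoGoodDeal.upperBound P F δ s t X) ∧
      -- representation by a dynamic no-good-deal pricing measure equivalent to `P`
      NoGoodDeal.IsDynamicNoGoodDealMeasure P F δ P₀ ∧
      (∀ s t, s ≤ t → ∀ X : NoGoodDeal.Linf P F t,
        ((xhat s t X : Lp ℝ ∞ P) : Ω → ℝ) =ᵐ[P] P₀[((X : Lp ℝ ∞ P) : Ω → ℝ) | F s]) := by
  set z : Set.Icc (0 : ℝ) T := ⟨0, le_rfl, hT.le⟩ with hz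
  set e : Set.Icc (0 : ℝ) T := ⟨T, hT.le, le_rfl⟩ with he
  obtain ⟨f, hf0, hfz, hf⟩ := exists_forall_mem_compatibleDensities hδ hL htc
    (fun s t hst => exists_mem_condDensities_forall_condExp_eq hst (hL t) (hL s)
      (hprice s t hst) (hsand s t hst)) (z := z) (e := e) (fun t => t.2.1) hFT
  have hze : z ≤ e := hT.le
  -- For the pair `(0, T)` the density `f` is its own relative density, so the positivity assumption
  -- on `m_0T` applies to it.
  have hfd : f ∈ condDensities P (F z) (F e) (1 + δ z e ^ 2) :=
    mem_condDensities_of_mem_relDensities (F.le z) (F.le e)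
      (by rw [hFT]; exact Lp.aestronglyMeasurable f) hfz (hf z e hze).1
  have hfpos : ∀ᵐ ω ∂P, 0 < f ω := ae_pos_of_lowerBound_pos hpos hfd
  have hQmem : (P.withDensity fun ω => ENNReal.ofReal (f ω)) ∈
      NoGoodDeal.boundedDensityMeasures P F δ z e := by
    rw [boundedDensityMeasures_eq_image]
    exact ⟨f, hfd, rfl⟩
  have hQprob : IsProbabilityMeasure (P.withDensity fun ω => ENNReal.ofReal (f ω)) := hQmem.1
  have hdyn := isDynamicNoGoodDealMeasure_withDensity hfpos fun s t hst => (hf s t hst).1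
  have hprice_eq := fun s t hst => price_eq_condExp_withDensity hL (hf s t hst) hfpos
  have hdiv := fun s t (hst : s ≤ t) => exists_mem_condDensities_div (F.le s) (F.le t)
    (F.mono hst) (by positivity) (hf s t hst).1 hfpos
  set Q := P.withDensity fun ω => ENNReal.ofReal (f ω) with hQ
  have hQP : Q ≪ P := hdyn.absolutelyContinuous
  have hPQ : P ≪ Q := hdyn.absolutelyContinuous'
  have hcoe : ∀ s (X : Lp ℝ ∞ P), (condExpLinf (F.le s) hPQ hQP X : Lp ℝ ∞ P) =ᵐ[P] Q[X | F s] :=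
    fun s X => coeFn_condExpLinf (F.le s) hPQ hQP X
  refine ⟨fun s t => (condExpLinf (F.le s) hPQ hQP).domRestrict (NoGoodDeal.Linf P F t), Q,
    fun s t _ => isPriceOperator_condExpLinf hPQ hQP, fun s u t hsu _ X => ?_,
    fun s t hst X => ?_, fun s t hst X _ => ?_, hdyn, fun s t _ X => hcoe s X⟩
  · refine Subtype.ext (Lp.ext ?_)
    have h1 := condExp_congr_ae (m := F s) (hQP.ae_le (hcoe u (X : Lp ℝ ∞ P)))
    have h2 := condExp_condExp_of_le (μ := Q) (f := ((X : Lp ℝ ∞ P) : Ω → ℝ)) (F.mono hsu)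
      (F.le u)
    filter_upwards [hcoe s (X : Lp ℝ ∞ P), hPQ.ae_le (h1.trans h2),
      hcoe s (condExpLinf (F.le u) hPQ hQP X : Lp ℝ ∞ P)] with ω h3 h4 h5
    exact h3.trans (h4.symm.trans h5.symm)
  · exact Lp.ext ((hcoe s X).trans (hprice_eq s t hst X).symm)
  -- The extended price is the value under the relative density `q`, one of the values over which
  -- `m_st` and `M_st` are taken.
  · obtain ⟨q, hq, -, hqX⟩ := hdiv s t hst
    have hmk : AEEqFun.mk (P[fun ω => q ω * (X : Lp ℝ ∞ P) ω | F s])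
        (stronglyMeasurable_condExp.mono (F.le s)).aestronglyMeasurable =
        ((condExpLinf (F.le s) hPQ hQP X : Lp ℝ ∞ P) : Ω →ₘ[P] ℝ) := by
      refine AEEqFun.ext ((AEEqFun.coeFn_mk _ _).trans ?_)
      exact (hqX X (mem_lpMeas_iff_aestronglyMeasurable.1 X.2)).trans (hcoe s X).symm
    exact ⟨(isGLB_lowerBound _).1 ⟨q, hq, hmk⟩, (isLUB_upperBound _).1 ⟨q, hq, hmk⟩⟩
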